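/- Let $n\ge 1$ and $N_n=\{1,\dots,n\}$. Let $\Gamma_n$ be the polyhedral cone of all set functions $h:2^{N_n}\to\mathbb R$ with $h(\emptyset)=0$ that are nonnegative, monotone ($h(A)\le h(B)$ for $A\subseteq B$) and submodular ($h(A\cap B)+h(A\cup B)\le h(A)+h(B)$). Let $\Gamma_n^*\subseteq\Gamma_n$ be the set of entropy functions $A\mapsto H(X_A)$ (natural logarithm) of random vectors $(X_i)_{i\in N_n}$ with finite alphabets; a set function is called entropic if it lies in $\Gamma_n^*$. A face of $\Gamma_n$ is a nonempty intersection of $\Gamma_n$ with a supporting hyperplane, its dimension is the dimension of its linear span, and an extreme ray is a $1$-dimensional face. A matroid $M$ on $N_n$ is given by its rank function $\mathbf r_M$, an integer-valued element of $\Gamma_n$ with $\mathbf r_M(A)\le |A|$ for all $A\subseteq N_n$. For $1\le n'\le n$ let $U_{1,n'}^n$ be the rank-one matroid with $\mathbf r(A)=\min\{1,|A\cap\{1,\dots,n'\}|\}$. For a matroid $M$ put $\chi_M=\{v\in\mathbb Z: v\ge 2,\ \log v\cdot\mathbf r_M\in\Gamma_n^*\}$, and for $a,b\ge 0$ let $(a,b)$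 stand for the polymatroid $a\,\mathbf r_M+b\,\mathbf r_{U_{1,n'}^n}$. We say that $(M,U_{1,n'}^n)$ is a $2$-dimensional face of $\Gamma_n$ if $\mathbf r_M$ and $\mathbf r_{U_{1,n'}^n}$ span extreme rays of $\Gamma_n$ and $\{a\,\mathbf r_M+b\,\mathbf r_{U_{1,n'}^n}:a,b\ge 0\}$ is a $2$-dimensional face of $\Gamma_n$. Such a face is called 1. *all-entropic* if $(a,b)$ is entropic for all $a,b>0$; 2. *Matúš-type* if, for $a,b\ge0$, $(a,b)$ is entropic whenever $\log(v-1)<a<\log v$ and $a+b\ge\log v$ for some $v\in\chi_M$, and $(a,b)$ is not entropic whenever $a+b<\log\lceil e^a\rceil$; 3. *Chen–Yeung-type* if $(\log v,b)$ is entropic for all $v\in\chi_M$ and $b>0$, and $(a,b)$ is not entropic whenever $a\ge 0$, $b>0$ and $a\ne\log v$ for every positive integer $v$; 4. *non-entropic* if $(a,b)$ is not entropic for all $a,b>0$. **Theorem.** Let $M$ be a matroid whose rank function spans an extreme ray of $\Gamma_n$, and let $1\le n'\le n$. If $(M,U_{1,n'}^n)$ is a $2$-dimensional face of $\Gamma_n$,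 then it is all-entropic, Matúš-type, Chen–Yeung-type or non-entropic. -/

import Mathlib

noncomputable section

namespace EntropyFaces

/-- The entropy space of degree `n`: real-valued set functions on the subsets of the ground set,
whose elements `1, …, n` are indexed by `Fin n`. -/
abbrev SetFn (n : ℕ) : Type := Finset (Fin n) → ℝ

/-- The polymatroidal region `Γ_n`: nonnegative, monotone, submodular set functions vanishing at
the empty set. -/
def Gam (n : ℕ) : Set (SetFn n) :=
  {h | h ∅ = 0 ∧ (∀ A, 0 ≤ h A) ∧ (∀ A B, A ⊆ B → h A ≤ h B) ∧
    ∀ A B, h (A ∩ B) + h (A ∪ B) ≤ h A + h B}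

/-! ### Entropy functions -/

open Classical in
/-- The probability mass function of the subvector `X_A` of a random vector `X` with finite
alphabets `𝒳 i` and joint probability mass function `p`. -/
def marginal {n : ℕ} {𝒳 : Fin n → Type} [∀ i, Fintype (𝒳 i)] (p : (∀ i, 𝒳 i) → ℝ)
    (A : Finset (Fin n)) (y : ∀ i : A, 𝒳 i) : ℝ :=
  ∑ x : (∀ i, 𝒳 i), if A.restrict x = y then p x else 0

/-- The entropy function `A ↦ H(X_A)` (natural logarithm) of a random vector with joint
probability mass function `p`; here `Real.negMulLog t = - t * log t`, which is `0` at `t = 0`. -/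
def entropyFn {n : ℕ} {𝒳 : Fin n → Type} [∀ i, Fintype (𝒳 i)] (p : (∀ i, 𝒳 i) → ℝ) : SetFn n :=
  fun A => ∑ y : (∀ i : A, 𝒳 i), Real.negMulLog (marginal p A y)

/-- The entropy region `Γ_n^*`: all entropy functions of random vectors `(X_1, …, X_n)` whose
components take values in finite alphabets. -/
def GamStar (n : ℕ) : Set (SetFn n) :=
  {h | ∃ (𝒳 : Fin n → Type) (_ : ∀ i, Fintype (𝒳 i)) (p : (∀ i, 𝒳 i) → ℝ),
    p ∈ stdSimplex ℝ (∀ i, 𝒳 i) ∧ h = entropyFn p}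

/-! ### Matroids -/

/-- `r` is the rank function of a matroid on the ground set: an integer-valued polymatroid with
`r A ≤ |A|` for every `A`. -/
def IsMatroidRank {n : ℕ} (r : SetFn n) : Prop :=
  r ∈ Gam n ∧ (∀ A, ∃ k : ℤ, r A = k) ∧ ∀ A, r A ≤ A.card

/-- The rank function of the matroid on the ground set whose restriction to `α` is the uniform
matroid of rank `k` and in which all elements outside `α` are loops. -/
def uniformRank {n : ℕ} (k : ℕ) (α : Finset (Fin n)) : SetFn n :=
  fun A => ((min k (A ∩ α).card : ℕ) : ℝ)

/-- The rank function of `U_{1,n'}^n`: the first `n'` elements are pairwise parallel and all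
other elements are loops. -/
def rankOne (n n' : ℕ) : SetFn n :=
  uniformRank 1 (Finset.univ.filter fun i : Fin n => i.val < n')

/-! ### Faces -/

/-- `F` is a `d`-dimensional face of `Γ_n`: a nonempty intersection of `Γ_n` with a supporting
hyperplane, the dimension being that of the linear span. -/
def IsFace {n : ℕ} (F : Set (SetFn n)) (d : ℕ) : Prop :=
  F.Nonempty ∧ IsExposed ℝ (Gam n) F ∧ Module.finrank ℝ (Submodule.span ℝ F) = d

/-- The ray `{t r : t ≥ 0}` is an extreme ray (a `1`-dimensional face) of `Γ_n`;
in particular `r ≠ 0`. -/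
def SpansExtremeRay {n : ℕ} (r : SetFn n) : Prop :=
  IsFace {h : SetFn n | ∃ t : ℝ, 0 ≤ t ∧ h = t • r} 1

/-- `(r₁, r₂)` is a `2`-dimensional face of `Γ_n`: the extreme rays through `r₁` and `r₂` span
a `2`-dimensional face. -/
def IsTwoFace {n : ℕ} (r₁ r₂ : SetFn n) : Prop :=
  SpansExtremeRay r₁ ∧ SpansExtremeRay r₂ ∧
    IsFace {h : SetFn n | ∃ a b : ℝ, 0 ≤ a ∧ 0 ≤ b ∧ h = a • r₁ + b • r₂} 2

/-! ### The four types of faces `(P, U_{1,n'}^n)`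

The set function `r` is the rank function of `P`; the point `(a, b)` of the first quadrant stands
for `a • r + b • rankOne n n'`. -/

/-- The probabilistic characteristic set `χ_P`. -/
def charSet {n : ℕ} (r : SetFn n) : Set ℤ :=
  {v | 2 ≤ v ∧ Real.log v • r ∈ GamStar n}

/-- The point `(a, b)` is entropic. -/
def EntropicAt {n : ℕ} (r : SetFn n) (n' : ℕ) (a b : ℝ) : Prop :=
  a • r + b • rankOne n n' ∈ GamStar n

def AllEntropic {n : ℕ} (r : SetFn n) (n' : ℕ) : Prop :=
  ∀ a b : ℝ, 0 < a → 0 < b → EntropicAt r n' a b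

def MatusType {n : ℕ} (r : SetFn n) (n' : ℕ) : Prop :=
  (∀ v ∈ charSet r, ∀ a b : ℝ, 0 ≤ a → 0 ≤ b → Real.log ((v : ℝ) - 1) < a → a < Real.log v →
      Real.log v ≤ a + b → EntropicAt r n' a b) ∧
    ∀ a b : ℝ, 0 ≤ a → 0 ≤ b → a + b < Real.log ⌈Real.exp a⌉ → ¬ EntropicAt r n' a b

def ChenYeungType {n : ℕ} (r : SetFn n) (n' : ℕ) : Prop :=
  (∀ v ∈ charSet r, ∀ b : ℝ, 0 < b → EntropicAt r n' (Real.log v) b) ∧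
    ∀ a b : ℝ, 0 ≤ a → 0 < b → (∀ v : ℤ, 1 ≤ v → a ≠ Real.log v) → ¬ EntropicAt r n' a b

def NonEntropic {n : ℕ} (r : SetFn n) (n' : ℕ) : Prop :=
  ∀ a b : ℝ, 0 < a → 0 < b → ¬ EntropicAt r n' a b

end EntropyFaces

end

/-! A random variable matters only through the partition it induces on the support of the law. There
`s ≤ t` means that `s` is finer, `s ⊓ t` is the joint variable, `s ⊔ t` the common part and `⊤` a
constant. With strictly positive weights, equalities of entropies become exact: zero conditional
entropy is refinement (`le_of_ent_le`), and equality in submodularity is factorisation of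
probabilities (`CondIndep.prob_mul`). Let `α` be the set of the first `n'` elements.

In rank one both generators are copies of single variables, so all points are entropic. In higher
rank, extremality makes the matroid connected up to loops, and every nonloop lies in a circuit with
at least three elements.

Suppose some nonloop `j` is outside `α`. Given the rest of a circuit, three of its elements behave
like a Latin square, each determined by the other two; if the extra randomness `b` does not
interfere, `X_j` is uniform and `a = log N` (`exists_ent_eq_log_nat`). This gives the Chen–Yeung
type unless the circuit is `{j, x, y}` with `x, y ∈ α`. The argument still works after conditioning
on a common part of `X_x` and `X_y` of entropy `b`. A loop in `α` is such a part; so is `X_x ⊔ X_y`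
when `α` has a third independent element, by the double Markov property (`ent_inf_sup`). In rank
two, a nonloop outside `α` not parallel to `j` again gives a good circuit. What remains is a
rank-two matroid in which the parallel class of `j`, together with the loops, contains the
complement of `α`. If it also meets `α`, then `r + U_{1,α}` has a further decomposition and there is
no two-dimensional face; if not, the type is Matúš: reweighting the law of `X_j` gives sufficiency,
counting the values of `X_j` gives necessity.

Suppose all nonloops are in `α`. If some `log v • r` is entropic, switching many independent copies
of it on with small probability reaches every point. If none is, a common part of entropy `b` would,
by conditioning on it and by extremality, produce an entropic multiple of `r`, so no point is
entropic. The only case without such a common part, rank two with no loop in `α`, is excluded by the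
same decomposition. -/

namespace EntropyFaces

/-! ### Entropies of partitions of a finite probability space -/

section Partitions

open Classical

variable {Ω : Type*} [Fintype Ω]

/-- The probability of the block of the partition `s` that contains `ω`. -/
noncomputable def prob (p : Ω → ℝ) (s : Setoid Ω) (ω : Ω) : ℝ :=
  ∑ ω', if s ω' ω then p ω' else 0

/-- The entropy of the partition `s`. -/
noncomputable def ent (p : Ω → ℝ) (s : Setoid Ω) : ℝ :=
  -∑ ω, p ω * Real.log (prob p s ω)

variable {p : Ω → ℝ}

theorem prob_congr {s : Setoid Ω} {ω ω' : Ω} (h : s ω ω') : prob p s ω = prob p s ω' := by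
  refine Finset.sum_congr rfl fun x _ => ?_
  have : s x ω ↔ s x ω' := ⟨fun hx => s.trans' hx h, fun hx => s.trans' hx (s.symm' h)⟩
  simp [this]

theorem le_prob (hp : ∀ ω, 0 ≤ p ω) (s : Setoid Ω) (ω : Ω) : p ω ≤ prob p s ω := by
  have := Finset.single_le_sum (f := fun ω' => if s ω' ω then p ω' else 0)
    (fun x _ => by split_ifs <;> simp [hp]) (Finset.mem_univ ω)
  simpa [prob, s.refl' ω] using this

theorem prob_nonneg (hp : ∀ ω, 0 ≤ p ω) (s : Setoid Ω) (ω : Ω) : 0 ≤ prob p s ω :=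
  (hp ω).trans (le_prob hp s ω)

theorem prob_pos (hp : ∀ ω, 0 < p ω) (s : Setoid Ω) (ω : Ω) : 0 < prob p s ω :=
  (hp ω).trans_le (le_prob (fun ω => (hp ω).le) s ω)

theorem prob_top (h1 : ∑ ω, p ω = 1) (ω : Ω) : prob p ⊤ ω = 1 := by
  simpa [prob, Setoid.top_def] using h1

theorem prob_mono (hp : ∀ ω, 0 ≤ p ω) {s t : Setoid Ω} (h : s ≤ t) (ω : Ω) :
    prob p s ω ≤ prob p t ω := by
  refine Finset.sum_le_sum fun x _ => ?_
  by_cases hs : s x ω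
  · simp [hs, h hs]
  · simp only [hs, if_false]; split_ifs <;> simp [hp]

theorem prob_le_one (hp : ∀ ω, 0 ≤ p ω) (h1 : ∑ ω, p ω = 1) (s : Setoid Ω) (ω : Ω) :
    prob p s ω ≤ 1 :=
  (prob_mono hp le_top ω).trans (prob_top h1 ω).le

theorem ent_nonneg (hp : ∀ ω, 0 ≤ p ω) (h1 : ∑ ω, p ω = 1) (s : Setoid Ω) : 0 ≤ ent p s := by
  rw [ent, neg_nonneg]
  exact Finset.sum_nonpos fun ω _ => mul_nonpos_of_nonneg_of_nonpos (hp ω)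
    (Real.log_nonpos (prob_nonneg hp s ω) (prob_le_one hp h1 s ω))

theorem ent_top (h1 : ∑ ω, p ω = 1) : ent p (⊤ : Setoid Ω) = 0 := by
  simp [ent, prob_top h1]

theorem ent_anti (hp : ∀ ω, 0 < p ω) {s t : Setoid Ω} (h : s ≤ t) : ent p t ≤ ent p s := by
  rw [ent, ent, neg_le_neg_iff]
  exact Finset.sum_le_sum fun ω _ => mul_le_mul_of_nonneg_left
    (Real.log_le_log (prob_pos hp s ω) (prob_mono (fun ω => (hp ω).le) h ω)) (hp ω).le

/-- A coarser partition with the same entropy is the same partition. -/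
theorem le_of_ent_le (hp : ∀ ω, 0 < p ω) {s t : Setoid Ω} (h : s ≤ t)
    (he : ent p s ≤ ent p t) : t ≤ s := by
  have hp' := fun ω => (hp ω).le
  -- The two entropies are sums of termwise comparable logarithms, so equality holds at every point
  -- because each weight is positive.
  have hlog : ∀ ω, prob p s ω = prob p t ω := by
    have h0 : ∀ ω ∈ Finset.univ, p ω * Real.log (prob p s ω) ≤ p ω * Real.log (prob p t ω) :=
      fun ω _ => mul_le_mul_of_nonneg_left
        (Real.log_le_log (prob_pos hp s ω) (prob_mono hp' h ω)) (hp ω).le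
    have hsum : ∑ ω, p ω * Real.log (prob p s ω) = ∑ ω, p ω * Real.log (prob p t ω) := by
      refine le_antisymm (Finset.sum_le_sum h0) ?_
      simpa [ent] using he
    intro ω
    have := (Finset.sum_eq_sum_iff_of_le h0).1 hsum ω (Finset.mem_univ ω)
    exact Real.log_injOn_pos (prob_pos hp s ω) (prob_pos hp t ω)
      (mul_left_cancel₀ (hp ω).ne' this)
  intro x y hxy
  by_contra hs
  have := hlog y
  -- A point `x` in the `t`-block but not in the `s`-block of `y` adds positive mass to the former.
  refine absurd this (ne_of_lt ?_)
  refine Finset.sum_lt_sum (fun z _ => ?_) ⟨x, Finset.mem_univ x, ?_⟩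
  · by_cases hz : s z y
    · simp [hz, h hz]
    · simp only [hz, if_false]; split_ifs <;> simp [hp']
  · simp [hs, hxy, hp x]

theorem le_of_ent_inf_le (hp : ∀ ω, 0 < p ω) {s t : Setoid Ω}
    (he : ent p (s ⊓ t) ≤ ent p t) : t ≤ s :=
  (le_of_ent_le hp inf_le_right he).trans inf_le_left

/-- A sum over the blocks of a partition as an expectation. -/
theorem sum_div_prob_mul (hp : ∀ ω, 0 < p ω) (s : Setoid Ω) (g : Quotient s → ℝ) :
    ∑ ω, p ω / prob p s ω * g (Quotient.mk s ω) = ∑ c, g c := by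
  rw [← Finset.sum_fiberwise (s := Finset.univ) (g := fun ω => Quotient.mk s ω)]
  refine Finset.sum_congr rfl fun q _ => ?_
  induction q using Quotient.inductionOn with
  | h ω =>
    have hrw : ∀ ω' ∈ Finset.univ.filter (fun ω' => Quotient.mk s ω' = Quotient.mk s ω),
        p ω' / prob p s ω' * g (Quotient.mk s ω') =
          p ω' * (g (Quotient.mk s ω) / prob p s ω) := by
      intro ω' h'
      have h2 := (Finset.mem_filter.1 h').2
      have : s ω' ω := Quotient.exact h2
      rw [prob_congr this, h2]
      ring
    rw [Finset.sum_congr rfl hrw, ← Finset.sum_mul, Finset.sum_filter]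
    have : ∑ a, (if Quotient.mk s a = Quotient.mk s ω then p a else 0) = prob p s ω :=
      Finset.sum_congr rfl fun x _ => if_congr Quotient.eq rfl rfl
    rw [this, mul_div_cancel₀ _ (prob_pos hp s ω).ne']

/-- The number of blocks as an expectation. -/
theorem sum_div_prob (hp : ∀ ω, 0 < p ω) (s : Setoid Ω) :
    ∑ ω, p ω / prob p s ω = Nat.card (Quotient s) := by
  simpa [Nat.card_eq_fintype_card] using sum_div_prob_mul hp s fun _ => 1

theorem card_quotient_pos [Nonempty Ω] (s : Setoid Ω) : 0 < Nat.card (Quotient s) :=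
  Nat.card_pos_iff.2 ⟨‹Nonempty Ω›.map (Quotient.mk s), inferInstance⟩

/-- Gibbs' inequality: average `log u ≤ u - 1` at `u = 1 / (N * prob)`; the mean of `1 / prob` is
the number `N` of blocks. -/
theorem ent_le_log_card [Nonempty Ω] (hp : ∀ ω, 0 < p ω) (h1 : ∑ ω, p ω = 1) (s : Setoid Ω) :
    ent p s ≤ Real.log (Nat.card (Quotient s)) := by
  have hN : (0 : ℝ) < Nat.card (Quotient s) := by exact_mod_cast card_quotient_pos s
  set N : ℝ := (Nat.card (Quotient s) : ℝ) with hNdef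
  have h : ∀ ω, p ω * (-Real.log (prob p s ω) - Real.log N) ≤ p ω / prob p s ω / N - p ω := by
    intro ω
    have hq := prob_pos hp s ω
    have := Real.log_le_sub_one_of_pos (inv_pos.2 (mul_pos hq hN))
    rw [Real.log_inv, Real.log_mul hq.ne' hN.ne'] at this
    have h2 := mul_le_mul_of_nonneg_left this (hp ω).le
    calc _ = p ω * (-(Real.log (prob p s ω) + Real.log N)) := by ring
      _ ≤ _ := h2
      _ = _ := by field_simp
  have h2 := Finset.sum_le_sum fun ω (_ : ω ∈ Finset.univ) => h ω
  rw [Finset.sum_sub_distrib, ← Finset.sum_div, sum_div_prob hp s, h1, ← hNdef,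
    div_self hN.ne', sub_self] at h2
  simp only [mul_sub, Finset.sum_sub_distrib, ← Finset.sum_mul, h1, mul_neg,
    Finset.sum_neg_distrib] at h2
  rw [ent]; linarith

/-- A uniformly distributed variable has the entropy of an integer. -/
theorem ent_eq_log_card_of_prob_const [Nonempty Ω] (hp : ∀ ω, 0 < p ω) (h1 : ∑ ω, p ω = 1)
    {s : Setoid Ω} (hs : ∀ ω ω', prob p s ω = prob p s ω') :
    ent p s = Real.log (Nat.card (Quotient s)) := by
  obtain ⟨ω₀⟩ := ‹Nonempty Ω›
  have hc := sum_div_prob hp s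
  simp only [hs _ ω₀, ← Finset.sum_div, h1] at hc
  rw [ent, ← hc]
  simp only [hs _ ω₀, ← Finset.sum_mul, h1]
  simp

/-- Summation over a block of a refinement. -/
theorem sum_block_div (hp : ∀ ω, 0 < p ω) {s : Setoid Ω} (ω : Ω) :
    ∑ ω', (if s ω' ω then p ω' / prob p s ω' else 0) = 1 := by
  have : ∀ ω', (if s ω' ω then p ω' / prob p s ω' else 0)
      = (if s ω' ω then p ω' else 0) / prob p s ω := by
    intro ω'
    split_ifs with h
    · rw [prob_congr h]
    · simp
  simp only [this, ← Finset.sum_div]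
  exact div_self (prob_pos hp s ω).ne'

/-- The product of block probabilities expands into pairs `x`, `y` with `x` in the `s`-block and `y`
in the `t`-block of `ω`. For a fixed pair the admissible `ω` are empty or one block of `s ⊓ t`, of
normalised weight `1`. The result is the mass, under two copies coupled independently over `k`, of
the pairs whose blocks meet. -/
theorem sum_prob_mul_prob (hp : ∀ ω, 0 < p ω) {s t k : Setoid Ω} (hs : s ≤ k) (ht : t ≤ k) :
    ∑ ω, p ω * (prob p s ω * prob p t ω / (prob p (s ⊓ t) ω * prob p k ω)) =
      ∑ x, ∑ y, if k y x then (p x * p y / prob p k x) *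
        (if ∃ ω, s ω x ∧ t ω y then 1 else 0) else 0 := by
  have e1 : ∀ ω, p ω * (prob p s ω * prob p t ω / (prob p (s ⊓ t) ω * prob p k ω)) =
      ∑ x, ∑ y, if s ω x ∧ t ω y then
        (p x * p y / prob p k x) * (p ω / prob p (s ⊓ t) ω) else 0 := by
    intro ω
    have : prob p s ω * prob p t ω
        = ∑ x, ∑ y, if s ω x ∧ t ω y then p x * p y else 0 := by
      rw [prob, prob, Finset.sum_mul_sum]
      refine Finset.sum_congr rfl fun x _ => Finset.sum_congr rfl fun y _ => ?_
      rw [s.comm' (x := x), t.comm' (x := y)]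
      by_cases h1 : s ω x <;> by_cases h2 : t ω y <;> simp [h1, h2]
    rw [this, Finset.sum_div, Finset.mul_sum]
    refine Finset.sum_congr rfl fun x _ => ?_
    rw [Finset.sum_div, Finset.mul_sum]
    refine Finset.sum_congr rfl fun y _ => ?_
    by_cases h : s ω x ∧ t ω y
    · rw [if_pos h, if_pos h, prob_congr (hs h.1)]
      have := prob_pos hp k x
      have := prob_pos hp (s ⊓ t) ω
      field_simp
    · simp [h]
  simp only [e1]
  rw [Finset.sum_comm]
  refine Finset.sum_congr rfl fun x _ => ?_
  rw [Finset.sum_comm]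
  refine Finset.sum_congr rfl fun y _ => ?_
  by_cases h : ∃ ω, s ω x ∧ t ω y
  · obtain ⟨ω₀, hx, hy⟩ := h
    have hk : k y x := k.trans' (k.symm' (ht hy)) (hs hx)
    have hiff : ∀ ω, (s ω x ∧ t ω y) ↔ (s ⊓ t) ω ω₀ := fun ω =>
      ⟨fun h => ⟨s.trans' h.1 (s.symm' hx), t.trans' h.2 (t.symm' hy)⟩,
        fun h => ⟨s.trans' h.1 hx, t.trans' h.2 hy⟩⟩
    rw [if_pos hk, if_pos ⟨ω₀, hx, hy⟩, ← sum_block_div hp ω₀ (s := s ⊓ t), Finset.mul_sum]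
    refine Finset.sum_congr rfl fun ω _ => ?_
    rw [mul_ite, mul_zero]
    exact if_congr (hiff ω) rfl rfl
  · have h' : ∀ ω, ¬ (s ω x ∧ t ω y) := fun ω hω => h ⟨ω, hω⟩
    simp [h']

theorem sum_pairs_block (hp : ∀ ω, 0 < p ω) (h1 : ∑ ω, p ω = 1) (k : Setoid Ω) :
    ∑ x, ∑ y, (if k y x then p x * p y / prob p k x else 0) = 1 := by
  rw [← h1]
  refine Finset.sum_congr rfl fun x _ => ?_
  have : ∀ y, (if k y x then p x * p y / prob p k x else 0)
      = p x / prob p k x * (if k y x then p y else 0) := by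
    intro y; split_ifs <;> ring
  simp only [this, ← Finset.mul_sum]
  exact div_mul_cancel₀ _ (prob_pos hp k x).ne'

theorem sum_ratio_le_one (hp : ∀ ω, 0 < p ω) (h1 : ∑ ω, p ω = 1) {s t k : Setoid Ω}
    (hs : s ≤ k) (ht : t ≤ k) :
    ∑ ω, p ω * (prob p s ω * prob p t ω / (prob p (s ⊓ t) ω * prob p k ω)) ≤ 1 := by
  rw [sum_prob_mul_prob hp hs ht]
  refine le_trans ?_ (sum_pairs_block hp h1 k).le
  refine Finset.sum_le_sum fun x _ => Finset.sum_le_sum fun y _ => ?_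
  have h0 : 0 ≤ p x * p y / prob p k x :=
    div_nonneg (mul_nonneg (hp x).le (hp y).le) (prob_pos hp k x).le
  by_cases hk : k y x
  · by_cases he : ∃ ω, s ω x ∧ t ω y <;> simp [hk, he, h0]
  · simp [hk]

theorem ent_ratio (hp : ∀ ω, 0 < p ω) (s t k : Setoid Ω) :
    ent p (s ⊓ t) + ent p k - (ent p s + ent p t) =
      ∑ ω, p ω * Real.log (prob p s ω * prob p t ω / (prob p (s ⊓ t) ω * prob p k ω)) := by
  have : ∀ ω, p ω * Real.log (prob p s ω * prob p t ω / (prob p (s ⊓ t) ω * prob p k ω)) =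
      p ω * Real.log (prob p s ω) + p ω * Real.log (prob p t ω)
        - (p ω * Real.log (prob p (s ⊓ t) ω) + p ω * Real.log (prob p k ω)) := by
    intro ω
    have a := (prob_pos hp s ω).ne'
    have b := (prob_pos hp t ω).ne'
    have c := (prob_pos hp (s ⊓ t) ω).ne'
    have d := (prob_pos hp k ω).ne'
    rw [Real.log_div (mul_ne_zero a b) (mul_ne_zero c d), Real.log_mul a b, Real.log_mul c d]
    ring
  simp only [this, Finset.sum_add_distrib, Finset.sum_sub_distrib, ent]
  ring

/-- Nonnegativity of the conditional mutual information of `s` and `t` given `k`. -/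
theorem ent_submodular (hp : ∀ ω, 0 < p ω) (h1 : ∑ ω, p ω = 1) {s t k : Setoid Ω}
    (hs : s ≤ k) (ht : t ≤ k) : ent p (s ⊓ t) + ent p k ≤ ent p s + ent p t := by
  have h := ent_ratio hp s t k
  have hle : ∑ ω, p ω * Real.log (prob p s ω * prob p t ω / (prob p (s ⊓ t) ω * prob p k ω)) ≤
      ∑ ω, p ω * (prob p s ω * prob p t ω / (prob p (s ⊓ t) ω * prob p k ω) - 1) :=
    Finset.sum_le_sum fun ω _ => mul_le_mul_of_nonneg_left
      (Real.log_le_sub_one_of_pos (div_pos (mul_pos (prob_pos hp _ _) (prob_pos hp _ _))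
        (mul_pos (prob_pos hp _ _) (prob_pos hp _ _)))) (hp ω).le
  have h2 := sum_ratio_le_one hp h1 hs ht
  simp only [mul_sub, Finset.sum_sub_distrib, mul_one, h1] at hle
  linarith

/-- Conditional independence of `s` and `t` given the coarser partition `k`. -/
structure CondIndep (p : Ω → ℝ) (s t k : Setoid Ω) : Prop where
  le_left : s ≤ k
  le_right : t ≤ k
  ent_le : ent p s + ent p t ≤ ent p (s ⊓ t) + ent p k

/-- Equality case of Gibbs' inequality: the ratio `q` has mean at most `1` while `log q` has
nonnegative mean, so `log q = q - 1` at every point, which forces `q = 1`. -/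
theorem CondIndep.prob_mul (hp : ∀ ω, 0 < p ω) (h1 : ∑ ω, p ω = 1) {s t k : Setoid Ω}
    (h : CondIndep p s t k) (ω : Ω) :
    prob p s ω * prob p t ω = prob p (s ⊓ t) ω * prob p k ω := by
  set q : Ω → ℝ := fun ω => prob p s ω * prob p t ω / (prob p (s ⊓ t) ω * prob p k ω) with hq
  have hqpos : ∀ ω, 0 < q ω := fun ω => div_pos (mul_pos (prob_pos hp _ _) (prob_pos hp _ _))
        (mul_pos (prob_pos hp _ _) (prob_pos hp _ _))
  have hr := ent_ratio hp s t k
  have hr' : 0 ≤ ∑ ω, p ω * Real.log (q ω) := by have := h.ent_le; rw [← hr]; linarith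
  have hle : ∀ ω ∈ Finset.univ, p ω * Real.log (q ω) ≤ p ω * (q ω - 1) :=
    fun ω _ => mul_le_mul_of_nonneg_left (Real.log_le_sub_one_of_pos (hqpos ω)) (hp ω).le
  have h2 := sum_ratio_le_one hp h1 h.le_left h.le_right
  have h3 : ∑ ω, p ω * (q ω - 1) ≤ 0 := by
    simp only [mul_sub, Finset.sum_sub_distrib, mul_one, h1]; linarith
  have h4 := (Finset.sum_eq_sum_iff_of_le hle).1
    (le_antisymm (Finset.sum_le_sum hle) (h3.trans hr')) ω (Finset.mem_univ ω)
  have h5 : Real.log (q ω) = q ω - 1 := mul_left_cancel₀ (hp ω).ne' h4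
  have h6 : q ω = 1 := by
    by_contra hne
    exact absurd h5 (Real.log_lt_sub_one_of_pos (hqpos ω) hne).ne
  exact (div_eq_one_iff_eq (mul_pos (prob_pos hp _ _) (prob_pos hp _ _)).ne').1 h6

/-- Once the probabilities factor, the pairs whose blocks meet carry the whole mass of the coupling
over `k`; a pair whose blocks miss each other would take away positive mass. Values compatible with
the same value of `k` therefore occur jointly. -/
theorem CondIndep.exists_of_rel (hp : ∀ ω, 0 < p ω) (h1 : ∑ ω, p ω = 1) {s t k : Setoid Ω}
    (h : CondIndep p s t k) {x y : Ω} (hxy : k x y) : ∃ ω, s ω x ∧ t ω y := by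
  have hsum : ∑ ω, p ω * (prob p s ω * prob p t ω / (prob p (s ⊓ t) ω * prob p k ω)) = 1 := by
    rw [← h1]
    refine Finset.sum_congr rfl fun ω _ => ?_
    rw [h.prob_mul hp h1, div_self (mul_pos (prob_pos hp _ _) (prob_pos hp _ _)).ne', mul_one]
  replace hsum := hsum.trans (sum_pairs_block hp h1 k).symm
  rw [sum_prob_mul_prob hp h.le_left h.le_right,
    ← Finset.sum_product', ← Finset.sum_product'] at hsum
  by_contra hne
  have hlt : ∑ z ∈ Finset.univ ×ˢ Finset.univ, (if k z.2 z.1 then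
      (p z.1 * p z.2 / prob p k z.1) * (if ∃ ω, s ω z.1 ∧ t ω z.2 then 1 else 0) else 0) <
      ∑ z ∈ Finset.univ ×ˢ Finset.univ,
        if k z.2 z.1 then p z.1 * p z.2 / prob p k z.1 else 0 := by
    have h0 : ∀ x y, 0 < p x * p y / prob p k x := fun x y =>
      div_pos (mul_pos (hp x) (hp y)) (prob_pos hp k x)
    refine Finset.sum_lt_sum (fun z _ => ?_) ⟨(x, y), by simp, ?_⟩
    · by_cases hk : k z.2 z.1
      · by_cases he : ∃ ω, s ω z.1 ∧ t ω z.2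
        · simp only [hk, he, if_true, mul_one, le_refl]
        · simpa only [hk, he, if_true, if_false, mul_zero] using (h0 z.1 z.2).le
      · simp [hk]
    · simp only [k.symm' hxy, hne, if_true, if_false, mul_zero]
      exact h0 x y
  exact absurd hsum hlt.ne

/-- If `f`, `g`, `e` are pairwise independent given `k`, if `f` and `g` determine each other given
`e`, and if `f` and `k` are independent, then `f` is uniformly distributed. -/
theorem exists_ent_eq_log_nat [Nonempty Ω] (hp : ∀ ω, 0 < p ω) (h1 : ∑ ω, p ω = 1)
    {f k G E : Setoid Ω}
    (hfg : CondIndep p (f ⊓ k) G k) (hfe : CondIndep p (f ⊓ k) E k) (hge : CondIndep p G E k)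
    (hg : f ⊓ k ⊓ E ≤ G) (hf : G ⊓ E ≤ f ⊓ k) (hfk : CondIndep p f k ⊤) :
    ∃ N : ℕ, 0 < N ∧ ent p f = Real.log N := by
  have heq : f ⊓ k ⊓ E = G ⊓ E := le_antisymm (le_inf hg inf_le_right) (le_inf hf inf_le_right)
  -- The joint partitions with `E` coincide and both factor over `k`; the common factor is
  -- cancelled.
  have hFG : ∀ ω, prob p (f ⊓ k) ω = prob p G ω := fun ω => by
    have a := hfe.prob_mul hp h1 ω
    have b := hge.prob_mul hp h1 ω
    rw [heq, ← b] at a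
    exact mul_right_cancel₀ (prob_pos hp E ω).ne' a
  -- Inside a `k`-block every value of `f` meets every value of `G`, so the equality of their
  -- probabilities makes both constant on the block. Independence of `f` and `k` then carries the
  -- constancy across blocks.
  have hF : ∀ {x y}, k x y → prob p (f ⊓ k) x = prob p (f ⊓ k) y := fun {x y} hxy => by
    obtain ⟨ω, hx, hy⟩ := hfg.exists_of_rel hp h1 hxy
    rw [← prob_congr hx, hFG, prob_congr hy, ← hFG]
  refine ⟨_, card_quotient_pos f, ent_eq_log_card_of_prob_const hp h1 (s := f) fun x y => ?_⟩
  obtain ⟨ω, hx, hy⟩ := hfk.exists_of_rel hp h1 (x := x) (y := y) (by trivial)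
  have a := hfk.prob_mul hp h1 ω
  have b := hfk.prob_mul hp h1 y
  rw [prob_top h1, mul_one] at a b
  rw [← prob_congr hx]
  rw [hF hy, ← b, prob_congr hy] at a
  exact mul_right_cancel₀ (prob_pos hp k y).ne' a

end Partitions

section Partitions

open Classical

variable {Ω : Type*} [Fintype Ω] {p : Ω → ℝ}

theorem inf_rel {Ω : Type*} (s t : Setoid Ω) (x y : Ω) : (s ⊓ t) x y ↔ s x y ∧ t x y :=
  Iff.rfl

theorem finset_inf_rel {ι Ω : Type*} (A : Finset ι) (S : ι → Setoid Ω) (x y : Ω) :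
    (A.inf S) x y ↔ ∀ i ∈ A, S i x y := by
  induction A using Finset.induction_on with
  | empty => rw [Finset.inf_empty]; exact ⟨fun _ => by simp, fun _ => trivial⟩
  | insert i A hi ih => rw [Finset.inf_insert, inf_rel, ih, Finset.forall_mem_insert]

/-! ### The common part of two partitions -/

/-- The conditional probability of the block of `a` at `ω₀` given the block of `s`. -/
noncomputable def condProb (p : Ω → ℝ) (a : Setoid Ω) (ω₀ : Ω) (s : Setoid Ω) (ω : Ω) : ℝ :=
  (∑ ω', if a ω' ω₀ ∧ s ω' ω then p ω' else 0) / prob p s ω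

theorem condProb_of_rel {a s : Setoid Ω} {ω₀ ω : Ω} (h : a ω ω₀) :
    condProb p a ω₀ s ω = prob p (a ⊓ s) ω / prob p s ω := by
  rw [condProb, prob]
  congr 1
  refine Finset.sum_congr rfl fun x _ => ?_
  refine if_congr ?_ rfl rfl
  change a x ω₀ ∧ s x ω ↔ a x ω ∧ s x ω
  exact and_congr_left fun _ => ⟨fun hx => a.trans' hx (a.symm' h), fun hx => a.trans' hx h⟩

theorem condProb_congr {a s : Setoid Ω} {ω₀ ω ω' : Ω} (h : s ω ω') :
    condProb p a ω₀ s ω = condProb p a ω₀ s ω' := by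
  rw [condProb, condProb, prob_congr h]
  congr 1
  refine Finset.sum_congr rfl fun x _ => if_congr ?_ rfl rfl
  exact and_congr_right fun _ => ⟨fun hx => s.trans' hx h, fun hx => s.trans' hx (s.symm' h)⟩

/-- If the `a`-block of `ω₀` meets the `b`-block of `ω`, it does so inside the `c`-block of `ω`, and
the factorisation can be cancelled; otherwise both sides vanish. -/
theorem CondIndep.condProb_eq (hp : ∀ ω, 0 < p ω) (h1 : ∑ ω, p ω = 1) {a b c : Setoid Ω}
    (h : CondIndep p (a ⊓ b) (c ⊓ b) b) (ω₀ ω : Ω) :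
    condProb p a ω₀ (c ⊓ b) ω = condProb p a ω₀ b ω := by
  by_cases hex : ∃ ω₁, a ω₁ ω₀ ∧ b ω₁ ω
  · obtain ⟨ω₁, ha, hb⟩ := hex
    obtain ⟨x, hx, hy⟩ := h.exists_of_rel hp h1 hb
    have hax : a x ω₀ := a.trans' hx.1 ha
    rw [← condProb_congr hy, ← condProb_congr hy.2, condProb_of_rel hax, condProb_of_rel hax,
      div_eq_div_iff (prob_pos hp _ _).ne' (prob_pos hp _ _).ne', h.prob_mul hp h1]
    congr 2
    rw [inf_inf_inf_comm, inf_idem, inf_assoc]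
  · have h2 : ∀ x, ¬ (a x ω₀ ∧ b x ω) := fun x hx => hex ⟨x, hx⟩
    have h3 : ∀ x, ¬ (a x ω₀ ∧ (c ⊓ b) x ω) := fun x hx => hex ⟨x, hx.1, hx.2.2⟩
    simp [condProb, h2, h3]

/-- The law of total probability inside one block of `t`. -/
theorem sum_mul_condProb (hp : ∀ ω, 0 < p ω) {s t : Setoid Ω} (h : s ≤ t) (a : Setoid Ω)
    (ω₀ ω : Ω) :
    ∑ x, (if t x ω then p x * condProb p a ω₀ s x else 0) =
      ∑ x, if a x ω₀ ∧ t x ω then p x else 0 := by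
  have e : ∀ x, (if t x ω then p x * condProb p a ω₀ s x else 0) =
      ∑ y, if a y ω₀ ∧ t y ω ∧ s x y then p y * (p x / prob p s x) else 0 := by
    intro x
    split_ifs with hx
    · rw [condProb, mul_div_assoc', mul_comm, ← mul_div_assoc', Finset.sum_mul]
      refine Finset.sum_congr rfl fun y _ => ?_
      rw [ite_mul, zero_mul]
      refine if_congr (and_congr_right fun _ => ?_) rfl rfl
      exact ⟨fun hs => ⟨t.trans' (h hs) hx, s.symm' hs⟩, fun hs => s.symm' hs.2⟩
    · symm
      refine Finset.sum_eq_zero fun y _ => if_neg fun hy => hx ?_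
      exact t.trans' (h hy.2.2) hy.2.1
  simp only [e]
  rw [Finset.sum_comm]
  refine Finset.sum_congr rfl fun y _ => ?_
  by_cases hy : a y ω₀ ∧ t y ω
  · simp only [hy, true_and, and_self, if_true]
    simpa only [Finset.mul_sum, mul_ite, mul_zero, mul_one] using
      congrArg (p y * ·) (sum_block_div hp (s := s) y)
  · have : ∀ x, ¬ (a y ω₀ ∧ t y ω ∧ s x y) := fun x hx => hy ⟨hx.1, hx.2.1⟩
    simp [this, hy]

/-- If `a`, `b` are independent given `c` and `a`, `c` are independent given `b`, then `a` is
independent of `(b, c)` given the common part `b ⊔ c` of `b` and `c`. -/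
theorem ent_inf_sup (hp : ∀ ω, 0 < p ω) (h1 : ∑ ω, p ω = 1) {a b c : Setoid Ω}
    (hc : CondIndep p (a ⊓ c) (b ⊓ c) c) (hb : CondIndep p (a ⊓ b) (c ⊓ b) b) :
    ent p (a ⊓ (b ⊓ c)) + ent p (b ⊔ c) = ent p (a ⊓ (b ⊔ c)) + ent p (b ⊓ c) := by
  have key : ∀ ω, prob p (a ⊓ (b ⊓ c)) ω * prob p (b ⊔ c) ω
      = prob p (a ⊓ (b ⊔ c)) ω * prob p (b ⊓ c) ω := by
    intro ω
    have e1 : condProb p a ω c = condProb p a ω b := by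
      funext x
      rw [← hc.condProb_eq hp h1, ← hb.condProb_eq hp h1, inf_comm]
    -- By `e1` the conditional probability of the `a`-block is one function, constant on `b`-blocks
    -- and on `c`-blocks; hence it factors through the common part.
    have hle : b ⊔ c ≤ Setoid.ker (condProb p a ω b) := by
      refine sup_le (fun x y h => ?_) (fun x y h => ?_)
      · exact condProb_congr h
      · rw [Setoid.ker_def, ← e1]; exact condProb_congr h
    have h2 := sum_mul_condProb hp (le_sup_left : b ≤ b ⊔ c) a ω ω
    have h3 : ∀ x, (if (b ⊔ c) x ω then p x * condProb p a ω b x else 0)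
        = (if (b ⊔ c) x ω then p x else 0) * condProb p a ω b ω := by
      intro x
      split_ifs with hx
      · rw [show condProb p a ω b x = condProb p a ω b ω from hle hx]
      · simp
    simp only [h3, ← Finset.sum_mul] at h2
    rw [← hb.condProb_eq hp h1, condProb_of_rel (a.refl' ω), inf_comm c b] at h2
    have h4 : prob p (b ⊔ c) ω * (prob p (a ⊓ (b ⊓ c)) ω / prob p (b ⊓ c) ω)
      = prob p (a ⊓ (b ⊔ c)) ω := by
      rw [prob, h2, prob]
      exact Finset.sum_congr rfl fun x _ => if_congr (inf_rel a _ x ω).symm rfl rfl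
    rw [← h4]
    have := (prob_pos hp (b ⊓ c) ω).ne'
    field_simp
  have hl : ∀ ω, p ω * Real.log (prob p (a ⊓ (b ⊓ c)) ω) + p ω * Real.log (prob p (b ⊔ c) ω)
      = p ω * Real.log (prob p (a ⊓ (b ⊔ c)) ω) + p ω * Real.log (prob p (b ⊓ c) ω) := by
    intro ω
    have := congrArg Real.log (key ω)
    rw [Real.log_mul (prob_pos hp _ _).ne' (prob_pos hp _ _).ne',
      Real.log_mul (prob_pos hp _ _).ne' (prob_pos hp _ _).ne'] at this
    rw [← mul_add, ← mul_add, this]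
  have := Finset.sum_congr (rfl : (Finset.univ : Finset Ω) = _) fun ω _ => hl ω
  simp only [Finset.sum_add_distrib] at this
  simp only [ent]
  linarith

/-! ### Conditioning on a block -/

/-- The conditional probabilities of the elements of the block of `k` at `ω₀`. -/
noncomputable def blockProb (p : Ω → ℝ) (k : Setoid Ω) (ω₀ : Ω) (ω : {ω // k ω ω₀}) : ℝ :=
  p ω / prob p k ω₀

theorem sum_block (k : Setoid Ω) (ω₀ : Ω) (g : Ω → ℝ) :
    ∑ ω : {ω // k ω ω₀}, g ω = ∑ ω, if k ω ω₀ then g ω else 0 := by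
  rw [← Finset.sum_filter]
  exact (Finset.sum_subtype _ (by simp) g).symm

theorem blockProb_pos (hp : ∀ ω, 0 < p ω) (k : Setoid Ω) (ω₀ : Ω) (ω : {ω // k ω ω₀}) :
    0 < blockProb p k ω₀ ω :=
  div_pos (hp _) (prob_pos hp _ _)

theorem sum_blockProb (hp : ∀ ω, 0 < p ω) (k : Setoid Ω) (ω₀ : Ω) :
    ∑ ω, blockProb p k ω₀ ω = 1 := by
  simp only [blockProb, ← Finset.sum_div]
  rw [sum_block k ω₀ p]
  exact div_self (prob_pos hp k ω₀).ne'

theorem prob_blockProb (k s : Setoid Ω) (ω₀ : Ω) (ω : {ω // k ω ω₀}) :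
    prob (blockProb p k ω₀) (s.comap Subtype.val) ω = prob p (s ⊓ k) ω / prob p k ω₀ := by
  have : ∀ ω' : {ω // k ω ω₀}, (if (s.comap Subtype.val) ω' ω then blockProb p k ω₀ ω' else 0)
      = (fun x => (if s x ω then p x else 0) / prob p k ω₀) ω' := by
    intro ω'
    simp only [Setoid.comap_rel, blockProb]
    split_ifs <;> simp
  rw [prob]
  simp only [this]
  rw [sum_block k ω₀ fun x => (if s x ω then p x else 0) / prob p k ω₀,
    prob.eq_1 p (s ⊓ k), Finset.sum_div]
  refine Finset.sum_congr rfl fun x _ => ?_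
  have hk : k x ω ↔ k x ω₀ :=
    ⟨fun h => k.trans' h ω.2, fun h => k.trans' h (k.symm' ω.2)⟩
  simp only [inf_rel, hk]
  by_cases h2 : k x ω₀ <;> simp [h2]

/-- The conditional entropy given `k` is the mean of the entropies on the blocks of `k`. -/
theorem sum_mul_ent_blockProb (hp : ∀ ω, 0 < p ω) (k s : Setoid Ω) :
    ∑ ω₀, p ω₀ * ent (blockProb p k ω₀) (s.comap Subtype.val) = ent p (s ⊓ k) - ent p k := by
  have e : ∀ ω₀, p ω₀ * ent (blockProb p k ω₀) (s.comap Subtype.val) =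
      -∑ ω, p ω * (Real.log (prob p (s ⊓ k) ω) - Real.log (prob p k ω)) *
        (if k ω₀ ω then p ω₀ / prob p k ω₀ else 0) := by
    intro ω₀
    have e1 : ∀ ω : {ω // k ω ω₀}, blockProb p k ω₀ ω *
        Real.log (prob (blockProb p k ω₀) (s.comap Subtype.val) ω) =
        (fun x => p x / prob p k ω₀ *
          (Real.log (prob p (s ⊓ k) x) - Real.log (prob p k ω₀))) ω := by
      intro ω
      rw [prob_blockProb, Real.log_div (prob_pos hp _ _).ne' (prob_pos hp _ _).ne', blockProb]
    rw [ent]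
    simp only [e1]
    rw [sum_block k ω₀ fun x => p x / prob p k ω₀ *
          (Real.log (prob p (s ⊓ k) x) - Real.log (prob p k ω₀)), mul_neg, Finset.mul_sum]
    congr 1
    refine Finset.sum_congr rfl fun x _ => ?_
    rw [k.comm' (x := ω₀)]
    split_ifs with h
    · rw [prob_congr h]; ring
    · simp
  simp only [e, Finset.sum_neg_distrib]
  rw [Finset.sum_comm]
  simp only [← Finset.mul_sum, sum_block_div hp, mul_one, mul_sub, Finset.sum_sub_distrib, ent]
  ring

end Partitions

/-! ### Entropic points as entropies of partitions -/

section GamStar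

open Classical

variable {n : ℕ}

/-- The entropies of the joint partitions of a family of partitions. -/
noncomputable def entFn {Ω : Type*} [Fintype Ω] (p : Ω → ℝ) (S : Fin n → Setoid Ω) : SetFn n :=
  fun A => ent p (A.inf S)

theorem entropyFn_apply {𝒳 : Fin n → Type} [∀ i, Fintype (𝒳 i)] (p : (∀ i, 𝒳 i) → ℝ)
    (A : Finset (Fin n)) :
    entropyFn p A = -∑ x, p x * Real.log (marginal p A (A.restrict x)) := by
  rw [entropyFn]
  have : ∀ y, Real.negMulLog (marginal p A y) =
      -∑ x, if A.restrict x = y then p x * Real.log (marginal p A (A.restrict x)) else 0 := by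
    intro y
    rw [Real.negMulLog, neg_mul, neg_inj]
    nth_rewrite 1 [marginal]
    rw [Finset.sum_mul]
    refine Finset.sum_congr rfl fun x _ => ?_
    split_ifs with h
    · rw [h]
    · simp
  simp only [this, Finset.sum_neg_distrib]
  rw [Finset.sum_comm]
  simp

/-- Null outcomes contribute nothing to any entropy and can be discarded. The strict positivity
gained is what lets equal entropies be read as equal partitions. -/
theorem exists_entFn_of_mem_GamStar {h : SetFn n} (hh : h ∈ GamStar n) :
    ∃ (Ω : Type) (_ : Fintype Ω) (p : Ω → ℝ) (S : Fin n → Setoid Ω),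
      (∀ ω, 0 < p ω) ∧ ∑ ω, p ω = 1 ∧ h = entFn p S := by
  obtain ⟨𝒳, _, p, hp, rfl⟩ := hh
  have hsum : ∀ g : (∀ i, 𝒳 i) → ℝ, (∀ x, p x = 0 → g x = 0) →
      ∑ x : {x // 0 < p x}, g x = ∑ x, g x := by
    intro g hg
    rw [← Finset.sum_subtype (Finset.univ.filter fun x => 0 < p x) (by simp) g, Finset.sum_filter]
    refine Finset.sum_congr rfl fun x _ => ?_
    rcases (hp.1 x).eq_or_lt with h0 | h0
    · simp [← h0, hg x h0.symm]
    · simp [h0]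
  refine ⟨{x // 0 < p x}, inferInstance, fun x => p x, fun i => Setoid.ker fun x => x.1 i,
    fun x => x.2, ?_, ?_⟩
  · rw [hsum p fun _ => id, hp.2]
  · funext A
    rw [entropyFn_apply, entFn, ent]
    have e : ∀ ω : {x // 0 < p x}, prob (fun x : {x // 0 < p x} => p x)
        (A.inf fun i => Setoid.ker fun x => x.1 i) ω = marginal p A (A.restrict ω.1) := by
      intro ω
      have hrel : ∀ x : {x // 0 < p x}, (A.inf fun i => Setoid.ker
          fun x : {x // 0 < p x} => x.1 i) x ω ↔ A.restrict x.1 = A.restrict ω.1 := by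
        intro x
        rw [finset_inf_rel]
        simp [funext_iff]
      rw [prob, marginal]
      simp only [hrel]
      exact hsum (fun x => if A.restrict x = A.restrict ω.1 then p x else 0)
        fun x hx => by simp [hx]
    simp only [e]
    rw [hsum (fun x => p x * Real.log (marginal p A (A.restrict x))) fun x hx => by simp [hx]]

/-- The quotient maps serve as the random vector, with the pushforward law. Zero weights are
allowed, since reweighted laws may have them. -/
theorem entFn_mem_GamStar {Ω : Type} [Fintype Ω] {p : Ω → ℝ} (hp : p ∈ stdSimplex ℝ Ω)
    (S : Fin n → Setoid Ω) : entFn p S ∈ GamStar n := by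
  set φ : Ω → ∀ i, Quotient (S i) := fun ω i => Quotient.mk (S i) ω with hφ
  set p' : (∀ i, Quotient (S i)) → ℝ := fun x => ∑ ω, if φ ω = x then p ω else 0 with hp'
  have hsum : ∀ g : (∀ i, Quotient (S i)) → ℝ, ∑ x, p' x * g x = ∑ ω, p ω * g (φ ω) := by
    intro g
    simp only [hp', Finset.sum_mul]
    rw [Finset.sum_comm]
    refine Finset.sum_congr rfl fun ω _ => ?_
    simp
  refine ⟨fun i => Quotient (S i), inferInstance, p', ⟨fun x => ?_, ?_⟩, ?_⟩
  · exact Finset.sum_nonneg fun ω _ => by split_ifs <;> simp [hp.1]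
  · simpa [hp.2] using hsum fun _ => 1
  · funext A
    rw [entropyFn_apply, entFn, ent, hsum fun x => Real.log (marginal p' A (A.restrict x))]
    congr 1
    refine Finset.sum_congr rfl fun ω _ => ?_
    congr 2
    have h2 : marginal p' A (A.restrict (φ ω)) =
        ∑ x, if A.restrict (φ x) = A.restrict (φ ω) then p x else 0 := by
      have := hsum fun x => if A.restrict x = A.restrict (φ ω) then 1 else 0
      simp only [mul_ite, mul_one, mul_zero] at this
      rw [marginal]
      convert this
    rw [h2, prob]
    refine Finset.sum_congr rfl fun x _ => if_congr ?_ rfl rfl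
    rw [finset_inf_rel]
    simp only [funext_iff, Finset.restrict, Subtype.forall, hφ]
    exact forall₂_congr fun i _ => (Quotient.eq (r := S i)).symm

theorem entFn_mem_Gam {Ω : Type*} [Fintype Ω] {p : Ω → ℝ} (hp : ∀ ω, 0 < p ω)
    (h1 : ∑ ω, p ω = 1) (S : Fin n → Setoid Ω) : entFn p S ∈ Gam n := by
  refine ⟨by simpa [entFn] using ent_top h1, fun A => ent_nonneg (fun ω => (hp ω).le) h1 _,
    fun A B hAB => ent_anti hp (Finset.inf_mono hAB), fun A B => ?_⟩
  have := ent_submodular hp h1 (s := A.inf S) (t := B.inf S) (k := (A ∩ B).inf S)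
    (Finset.inf_mono Finset.inter_subset_left) (Finset.inf_mono Finset.inter_subset_right)
  rw [← Finset.inf_union] at this
  simp only [entFn]
  linarith

/-- The joint law of two independent families. -/
theorem add_mem_GamStar {h₁ h₂ : SetFn n} (H₁ : h₁ ∈ GamStar n) (H₂ : h₂ ∈ GamStar n) :
    h₁ + h₂ ∈ GamStar n := by
  obtain ⟨Ω₁, _, p, S, hp, hp1, rfl⟩ := exists_entFn_of_mem_GamStar H₁
  obtain ⟨Ω₂, _, q, T, hq, hq1, rfl⟩ := exists_entFn_of_mem_GamStar H₂
  have hsum : ∀ (f : Ω₁ → ℝ) (g : Ω₂ → ℝ), ∑ x : Ω₁ × Ω₂, f x.1 * g x.2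
      = (∑ x, f x) * ∑ y, g y := fun f g => by
    rw [Finset.sum_mul_sum, Fintype.sum_prod_type]
  have hmem : (fun x : Ω₁ × Ω₂ => p x.1 * q x.2) ∈ stdSimplex ℝ (Ω₁ × Ω₂) :=
    ⟨fun x => mul_nonneg (hp _).le (hq _).le, by rw [hsum, hp1, hq1, one_mul]⟩
  convert entFn_mem_GamStar hmem fun i => (S i).prod (T i) using 1
  funext A
  have hrel : ∀ x y : Ω₁ × Ω₂, (A.inf fun i => (S i).prod (T i)) x y ↔
      (A.inf S) x.1 y.1 ∧ (A.inf T) x.2 y.2 := by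
    intro x y
    simp only [finset_inf_rel]
    exact ⟨fun h => ⟨fun i hi => (h i hi).1, fun i hi => (h i hi).2⟩,
      fun h i hi => ⟨h.1 i hi, h.2 i hi⟩⟩
  have hprob : ∀ x : Ω₁ × Ω₂, prob (fun x : Ω₁ × Ω₂ => p x.1 * q x.2)
      (A.inf fun i => (S i).prod (T i)) x = prob p (A.inf S) x.1 * prob q (A.inf T) x.2 := by
    intro x
    rw [prob, prob, prob, ← hsum]
    refine Finset.sum_congr rfl fun y _ => ?_
    rw [hrel]
    by_cases h1 : (A.inf S) y.1 x.1 <;> by_cases h2 : (A.inf T) y.2 x.2 <;> simp [h1, h2]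
  simp only [Pi.add_apply, entFn, ent, hprob]
  have : ∀ x : Ω₁ × Ω₂, p x.1 * q x.2 *
      Real.log (prob p (A.inf S) x.1 * prob q (A.inf T) x.2) =
      (p x.1 * Real.log (prob p (A.inf S) x.1)) * q x.2 +
        p x.1 * (q x.2 * Real.log (prob q (A.inf T) x.2)) := by
    intro x
    rw [Real.log_mul (prob_pos hp _ _).ne' (prob_pos hq _ _).ne']
    ring
  simp only [this, Finset.sum_add_distrib]
  rw [hsum (fun x => p x * Real.log (prob p (A.inf S) x)) q,
    hsum p (fun y => q y * Real.log (prob q (A.inf T) y)), hp1, hq1]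
  ring

end GamStar

/-! ### Explicit constructions of entropic points -/

section Constructions

open Classical

variable {n : ℕ}

theorem uniformRank_one (β A : Finset (Fin n)) :
    uniformRank 1 β A = if ∃ i ∈ A, i ∈ β then 1 else 0 := by
  rw [uniformRank]
  split_ifs with h
  · obtain ⟨i, hA, hβ⟩ := h
    have : 1 ≤ (A ∩ β).card := Finset.card_pos.2 ⟨i, Finset.mem_inter.2 ⟨hA, hβ⟩⟩
    simp [this]
  · have : A ∩ β = ∅ := Finset.eq_empty_of_forall_notMem fun i hi =>
      h ⟨i, Finset.mem_inter.1 hi⟩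
    simp [this]

theorem prob_bot {Ω : Type*} [Fintype Ω] (q : Ω → ℝ) (ω : Ω) : prob q ⊥ ω = q ω := by
  rw [prob]
  simp

/-- Every value between `0` and `log |Ω|` is the entropy of a distribution on `Ω`. -/
theorem exists_ent_bot_eq {Ω : Type*} [Fintype Ω] [Nonempty Ω] {a : ℝ} (h0 : 0 ≤ a)
    (ha : a ≤ Real.log (Fintype.card Ω)) : ∃ q ∈ stdSimplex ℝ Ω, ent q ⊥ = a := by
  have hent : ∀ q : Ω → ℝ, ent q ⊥ = ∑ ω, Real.negMulLog (q ω) := fun q => by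
    simp [ent, prob_bot, Real.negMulLog]
  have hcont : ContinuousOn (fun q : Ω → ℝ => ∑ ω, Real.negMulLog (q ω)) (stdSimplex ℝ Ω) :=
    (continuous_finsetSum _ fun ω _ =>
      Real.continuous_negMulLog.comp (continuous_apply ω)).continuousOn
  obtain ⟨ω₀⟩ := ‹Nonempty Ω›
  have hN : (0 : ℝ) < Fintype.card Ω := by exact_mod_cast Fintype.card_pos_iff.2 ⟨ω₀⟩
  have hδ : (Pi.single ω₀ 1 : Ω → ℝ) ∈ stdSimplex ℝ Ω := single_mem_stdSimplex ℝ ω₀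
  have hu : (fun _ => (Fintype.card Ω : ℝ)⁻¹ : Ω → ℝ) ∈ stdSimplex ℝ Ω :=
    ⟨fun _ => by positivity, by simp [hN.ne']⟩
  -- The simplex is connected, and the entropy runs from `0` at a point mass to `log |Ω|` at the
  -- uniform law.
  obtain ⟨q, hq, hqa⟩ := (convex_stdSimplex ℝ Ω).isPreconnected.intermediate_value hδ hu hcont
    (show a ∈ Set.Icc _ _ by
      refine ⟨?_, ?_⟩
      · refine le_trans (le_of_eq (Finset.sum_eq_zero fun ω _ => ?_)) h0
        by_cases h : ω = ω₀
        · subst h; simp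
        · simp [h]
      · refine ha.trans (le_of_eq ?_)
        simp [Real.negMulLog])
  exact ⟨q, hq, (hent q).trans hqa⟩

/-- A single variable of entropy `b` is copied to all of `β`, the other components being constant;
an alphabet with more than `exp b` letters has room for it. -/
theorem smul_uniformRank_one_mem_GamStar (β : Finset (Fin n)) {b : ℝ} (hb : 0 ≤ b) :
    b • uniformRank 1 β ∈ GamStar n := by
  obtain ⟨N, hN⟩ := exists_nat_gt (Real.exp b)
  have hNpos : (0 : ℝ) < N := (Real.exp_pos b).trans hN
  have : Nonempty (Fin N) := ⟨⟨0, by exact_mod_cast hNpos⟩⟩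
  obtain ⟨q, hq, hqb⟩ := exists_ent_bot_eq (Ω := Fin N) hb (by
    rw [Fintype.card_fin]; exact (Real.le_log_iff_exp_le hNpos).2 hN.le)
  convert entFn_mem_GamStar hq fun i : Fin n => if i ∈ β then ⊥ else ⊤ using 1
  funext A
  rw [Pi.smul_apply, uniformRank_one, entFn]
  split_ifs with h
  · obtain ⟨i, hA, hβ⟩ := h
    have : (A.inf fun i => if i ∈ β then (⊥ : Setoid (Fin N)) else ⊤) = ⊥ :=
      le_bot_iff.1 ((Finset.inf_le hA).trans (by simp [hβ]))
    rw [this, hqb]; simp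
  · have : (A.inf fun i => if i ∈ β then (⊥ : Setoid (Fin N)) else ⊤) = ⊤ :=
      top_le_iff.1 (Finset.le_inf fun i hi => by
        have : i ∉ β := fun hβ => h ⟨i, hi, hβ⟩
        simp [this])
    rw [this, ent_top hq.2]; simp

/-- The mixture of an entropic vector with a constant one, when the switch is observed by the
elements of `α` and the others are constant. -/
theorem mixture_mem_GamStar {h : SetFn n} (hh : h ∈ GamStar n) (α : Finset (Fin n))
    (hα : ∀ A, h A = h (A ∩ α)) {θ : ℝ} (h0 : 0 < θ) (h1 : θ < 1) :
    θ • h + Real.binEntropy θ • uniformRank 1 α ∈ GamStar n := by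
  obtain ⟨Ω, _, p, S, hp, hp1, rfl⟩ := exists_entFn_of_mem_GamStar hh
  set p' : Option Ω → ℝ := fun x => x.elim (1 - θ) fun ω => θ * p ω with hp'
  have hp'mem : p' ∈ stdSimplex ℝ (Option Ω) := by
    refine ⟨fun x => ?_, ?_⟩
    · cases x with
      | none => simp [hp', h1.le]
      | some ω => exact mul_nonneg h0.le (hp ω).le
    · simp [hp', Fintype.sum_option, ← Finset.mul_sum, hp1]
  -- The outcome `none` is a block of its own, so every element of `α` sees the switch.
  let T : Setoid Ω → Setoid (Option Ω) := fun s => Setoid.ker (Option.map (Quotient.mk s))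
  have hT : ∀ (s : Setoid Ω) x y, T s (some x) (some y) ↔ s x y := fun s x y => by
    simp only [T, Setoid.ker_def, Option.map_some, Option.some_inj]
    exact Quotient.eq
  have hT0 : ∀ (s : Setoid Ω) x, ¬ T s (some x) none := fun s x => by
    simp [T, Setoid.ker_def]
  convert entFn_mem_GamStar hp'mem fun i : Fin n => if i ∈ α then T (S i) else ⊤ using 1
  funext A
  rw [Pi.add_apply, Pi.smul_apply, Pi.smul_apply, uniformRank_one, hα A]
  by_cases hA : ∃ i ∈ A, i ∈ α
  · have hrel : (A.inf fun i => if i ∈ α then T (S i) else ⊤) = T ((A ∩ α).inf S) := by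
      ext x y
      rw [finset_inf_rel]
      obtain ⟨j, hj, hjα⟩ := hA
      constructor
      · intro hxy
        have hj' := hxy j hj
        rw [if_pos hjα] at hj'
        cases x with
        | none =>
          cases y with
          | none => exact Setoid.refl' _ _
          | some y => exact absurd (Setoid.symm' _ hj') (hT0 _ _)
        | some x =>
          cases y with
          | none => exact absurd hj' (hT0 _ _)
          | some y =>
            rw [hT, finset_inf_rel]
            intro i hi
            have := hxy i (Finset.mem_inter.1 hi).1
            rwa [if_pos (Finset.mem_inter.1 hi).2, hT] at this
      · intro hxy i hi
        by_cases hiα : i ∈ α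
        · rw [if_pos hiα]
          cases x with
          | none =>
            cases y with
            | none => exact Setoid.refl' _ _
            | some y => exact absurd (Setoid.symm' _ hxy) (hT0 _ _)
          | some x =>
            cases y with
            | none => exact absurd hxy (hT0 _ _)
            | some y =>
              rw [hT, finset_inf_rel] at hxy
              exact (hT _ _ _).2 (hxy i (Finset.mem_inter.2 ⟨hi, hiα⟩))
        · rw [if_neg hiα]; trivial
    rw [if_pos hA, entFn, entFn, hrel]
    set s := (A ∩ α).inf S
    have e0 : prob p' (T s) none = 1 - θ := by
      rw [prob, Fintype.sum_option, if_pos (Setoid.refl' _ _),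
        Finset.sum_eq_zero fun x _ => if_neg (hT0 s x)]
      simp [hp']
    have e1 : ∀ ω, prob p' (T s) (some ω) = θ * prob p s ω := by
      intro ω
      rw [prob, Fintype.sum_option, if_neg fun hc => hT0 s ω (Setoid.symm' _ hc), zero_add, prob,
        Finset.mul_sum]
      refine Finset.sum_congr rfl fun x _ => ?_
      rw [if_congr (hT s x ω) rfl rfl]
      split_ifs <;> simp [hp']
    have e2 : ∀ ω, θ * p ω * Real.log (θ * prob p s ω)
        = θ * Real.log θ * p ω + θ * (p ω * Real.log (prob p s ω)) := fun ω => by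
      rw [Real.log_mul h0.ne' (prob_pos hp s ω).ne']; ring
    rw [ent.eq_1 p', Fintype.sum_option, e0]
    simp only [e1]
    simp only [hp', Option.elim_none, Option.elim_some, e2, Finset.sum_add_distrib,
      ← Finset.mul_sum, hp1]
    rw [Real.binEntropy_eq_negMulLog_add_negMulLog_one_sub, Real.negMulLog, Real.negMulLog, ent]
    simp only [smul_eq_mul]
    ring
  · have hrel : (A.inf fun i => if i ∈ α then T (S i) else ⊤) = ⊤ :=
      top_le_iff.1 (Finset.le_inf fun i hi => by
        have : i ∉ α := fun hβ => hA ⟨i, hi, hβ⟩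
        simp [this])
    have hAα : A ∩ α = ∅ := Finset.eq_empty_of_forall_notMem fun i hi =>
      hA ⟨i, Finset.mem_inter.1 hi⟩
    rw [if_neg hA, entFn, entFn, hrel, ent_top hp'mem.2, hAα, Finset.inf_empty, ent_top hp1]
    simp

/-! ### Changing the distribution of one variable -/

variable {Ω : Type*} [Fintype Ω] {p : Ω → ℝ}

/-- The distribution obtained from `p` by giving the variable `f` the distribution `q` and keeping
the conditional distribution given `f`. -/
noncomputable def reweight (p : Ω → ℝ) (f : Setoid Ω) (q : Quotient f → ℝ) (ω : Ω) : ℝ :=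
  p ω / prob p f ω * q (Quotient.mk f ω)

theorem reweight_mem (hp : ∀ ω, 0 < p ω) (f : Setoid Ω) {q : Quotient f → ℝ}
    (hq : q ∈ stdSimplex ℝ (Quotient f)) : reweight p f q ∈ stdSimplex ℝ Ω :=
  ⟨fun ω => mul_nonneg (div_nonneg (hp ω).le (prob_pos hp f ω).le) (hq.1 _),
    (sum_div_prob_mul hp f q).trans hq.2⟩

theorem prob_reweight_of_le {s f : Setoid Ω} (h : s ≤ f) (q : Quotient f → ℝ)
    (ω : Ω) : prob (reweight p f q) s ω = prob p s ω / prob p f ω * q (Quotient.mk f ω) := by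
  rw [prob, prob.eq_1 p s, Finset.sum_div, Finset.sum_mul]
  refine Finset.sum_congr rfl fun x _ => ?_
  split_ifs with hx
  · rw [reweight, prob_congr (h hx), Quotient.sound (s := f) (h hx)]
  · simp

theorem ent_reweight (hp : ∀ ω, 0 < p ω) (f : Setoid Ω) (q : Quotient f → ℝ) :
    ent (reweight p f q) f = ent q ⊥ := by
  have e : ∀ ω, prob (reweight p f q) f ω = q (Quotient.mk f ω) := fun ω => by
    rw [prob_reweight_of_le le_rfl, div_self (prob_pos hp f ω).ne', one_mul]
  rw [ent, ent]
  simp only [e, prob_bot]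
  rw [← sum_div_prob_mul hp f fun c => q c * Real.log (q c)]
  simp only [reweight, mul_assoc]

/-- The conditional law of `s` given any value of `f` is its unconditional law, so averaging over
another law of `f` returns it. -/
theorem prob_reweight_of_indep (hp : ∀ ω, 0 < p ω) (h1 : ∑ ω, p ω = 1) {s f : Setoid Ω}
    (h : CondIndep p s f ⊤) {q : Quotient f → ℝ} (hq : q ∈ stdSimplex ℝ (Quotient f)) (ω : Ω) :
    prob (reweight p f q) s ω = prob p s ω := by
  have e : ∀ x, (if s x ω then reweight p f q x else 0) =
      ∑ y, (if f y x then p y / prob p f y else 0) *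
        (if s x ω then p x / prob p f y * q (Quotient.mk f y) else 0) := by
    intro x
    split_ifs with hx
    · rw [← mul_one (reweight p f q x), ← sum_block_div hp (s := f) x, Finset.mul_sum]
      refine Finset.sum_congr rfl fun y _ => ?_
      split_ifs with hy
      · rw [reweight, prob_congr hy, Quotient.sound (s := f) hy]; ring
      · simp
    · simp
  rw [prob]
  simp only [e]
  rw [Finset.sum_comm]
  have e2 : ∀ y, ∑ x, (if f y x then p y / prob p f y else 0) *
        (if s x ω then p x / prob p f y * q (Quotient.mk f y) else 0) =
      p y / prob p f y * q (Quotient.mk f y) * prob p s ω := by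
    intro y
    obtain ⟨z, hz, hy⟩ := h.exists_of_rel hp h1 (x := ω) (y := y) (by trivial)
    have hm := h.prob_mul hp h1 z
    rw [prob_top h1, mul_one, prob_congr hz, prob_congr hy] at hm
    have hfy := (prob_pos hp f y).ne'
    have e3 : prob p s ω = prob p (s ⊓ f) z / prob p f y := by rw [← hm]; field_simp
    rw [e3, prob.eq_1 p (s ⊓ f), Finset.sum_div, Finset.mul_sum]
    refine Finset.sum_congr rfl fun x _ => ?_
    have h3 : (s ⊓ f) x z ↔ f y x ∧ s x ω :=
      ⟨fun hx => ⟨f.symm' (f.trans' hx.2 hy), s.trans' hx.1 hz⟩,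
        fun hx => ⟨s.trans' hx.2 (s.symm' hz), f.trans' (f.symm' hx.1) (f.symm' hy)⟩⟩
    rw [if_congr h3 rfl rfl]
    by_cases h4 : f y x <;> by_cases h5 : s x ω <;> simp [h4, h5]
    field_simp
  simp only [e2, ← Finset.sum_mul]
  rw [sum_div_prob_mul hp f q, hq.2, one_mul]

theorem ent_reweight_of_indep (hp : ∀ ω, 0 < p ω) (h1 : ∑ ω, p ω = 1) {s f : Setoid Ω}
    (h : CondIndep p s f ⊤) {q : Quotient f → ℝ} (hq : q ∈ stdSimplex ℝ (Quotient f)) :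
    ent (reweight p f q) s = ent p s := by
  -- The weights differ point by point, so each term is spread over its `s`-block; the sum then
  -- depends on block probabilities only.
  have e : ∀ (p' : Ω → ℝ), (∀ ω, prob p' s ω = prob p s ω) →
      ent p' s = -∑ ω, ∑ x, if s x ω then p' x * (p ω / prob p s ω * Real.log (prob p s ω))
        else 0 := by
    intro p' hp'
    rw [ent, Finset.sum_comm]
    congr 1
    refine Finset.sum_congr rfl fun x _ => ?_
    rw [hp', ← mul_one (Real.log _), ← sum_block_div hp (s := s) x, Finset.mul_sum,
      Finset.mul_sum]
    refine Finset.sum_congr rfl fun ω _ => ?_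
    rw [s.comm' (x := x)]
    split_ifs with hx
    · rw [prob_congr hx]; ring
    · simp
  have hr := prob_reweight_of_indep hp h1 h hq
  rw [e _ hr, e p fun _ => rfl]
  congr 1
  refine Finset.sum_congr rfl fun ω _ => ?_
  have e2 : ∀ p' : Ω → ℝ, ∑ x, (if s x ω then
      p' x * (p ω / prob p s ω * Real.log (prob p s ω)) else 0) =
      prob p' s ω * (p ω / prob p s ω * Real.log (prob p s ω)) := by
    intro p'
    rw [prob.eq_1 p', Finset.sum_mul]
    exact Finset.sum_congr rfl fun x _ => by split_ifs <;> simp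
  rw [e2, e2, hr]

theorem ent_reweight_inf (hp : ∀ ω, 0 < p ω) (h1 : ∑ ω, p ω = 1) {s f : Setoid Ω}
    (h : CondIndep p s f ⊤) {q : Quotient f → ℝ} (hq : q ∈ stdSimplex ℝ (Quotient f)) :
    ent (reweight p f q) (s ⊓ f) = ent p s + ent q ⊥ := by
  rw [← ent_reweight_of_indep hp h1 h hq, ← ent_reweight hp f q, ent, ent, ent, ← neg_add,
    ← Finset.sum_add_distrib]
  congr 1
  refine Finset.sum_congr rfl fun ω _ => ?_
  have hm := h.prob_mul hp h1 ω
  rw [prob_top h1, mul_one] at hm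
  have hf := (prob_pos hp f ω).ne'
  rw [prob_reweight_of_le inf_le_right, prob_reweight_of_le le_rfl, ← hm,
    prob_reweight_of_indep hp h1 h hq, mul_div_cancel_right₀ _ hf, div_self hf, one_mul]
  by_cases hq0 : q (Quotient.mk f ω) = 0
  · simp [reweight, hq0]
  · rw [Real.log_mul (prob_pos hp s ω).ne' hq0]; ring

end Constructions

/-! ### Faces of the polymatroidal region -/

section Faces

variable {n : ℕ}

theorem zero_mem_Gam : (0 : SetFn n) ∈ Gam n :=
  ⟨rfl, fun _ => le_rfl, fun _ _ _ => le_rfl, fun _ _ => by simp⟩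

theorem add_mem_Gam {g h : SetFn n} (hg : g ∈ Gam n) (hh : h ∈ Gam n) : g + h ∈ Gam n := by
  obtain ⟨g0, g1, g2, g3⟩ := hg
  obtain ⟨h0, h1, h2, h3⟩ := hh
  refine ⟨by simp [g0, h0], fun A => add_nonneg (g1 A) (h1 A),
    fun A B hAB => add_le_add (g2 A B hAB) (h2 A B hAB), fun A B => ?_⟩
  simp only [Pi.add_apply]
  linarith [g3 A B, h3 A B]

theorem GamStar_subset_Gam : GamStar n ⊆ Gam n := by
  intro h hh
  obtain ⟨Ω, _, p, S, hp, h1, rfl⟩ := exists_entFn_of_mem_GamStar hh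
  exact entFn_mem_Gam hp h1 S

theorem uniformRank_one_mem_Gam (β : Finset (Fin n)) : uniformRank 1 β ∈ Gam n := by
  simpa using GamStar_subset_Gam (smul_uniformRank_one_mem_GamStar β zero_le_one)

theorem restrict_mem_Gam {r : SetFn n} (hr : r ∈ Gam n) (L : Finset (Fin n)) :
    (fun A => r (A ∩ L)) ∈ Gam n := by
  obtain ⟨h0, h1, h2, h3⟩ := hr
  refine ⟨by simp [h0], fun A => h1 _, fun A B hAB => h2 _ _ (Finset.inter_subset_inter_right hAB),
    fun A B => ?_⟩
  have := h3 (A ∩ L) (B ∩ L)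
  rwa [← Finset.inter_inter_distrib_right, ← Finset.union_inter_distrib_right] at this

/-- A face is the zero set of a functional that is nonpositive on the cone. -/
theorem exists_functional_of_face {F : Set (SetFn n)} (hne : F.Nonempty)
    (hF : IsExposed ℝ (Gam n) F) :
    ∃ l : SetFn n →L[ℝ] ℝ, (∀ x ∈ Gam n, l x ≤ 0) ∧ ∀ x, x ∈ F ↔ x ∈ Gam n ∧ l x = 0 := by
  obtain ⟨l, rfl⟩ := hF hne
  obtain ⟨x₀, hx₀, hmax⟩ := hne
  -- On a cone the maximum of a linear functional can only be `0`: compare with the origin and with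
  -- `x₀ + x₀`.
  have h0 : l x₀ = 0 := by
    have a := hmax 0 zero_mem_Gam
    have b := hmax (x₀ + x₀) (add_mem_Gam hx₀ hx₀)
    rw [map_zero] at a
    rw [map_add] at b
    linarith
  rw [h0] at hmax
  refine ⟨l, hmax, fun x => ⟨fun hx => ⟨hx.1, ?_⟩, fun hx => ⟨hx.1, fun y hy => ?_⟩⟩⟩
  · exact le_antisymm (hmax x hx.1) (h0 ▸ hx.2 x₀ hx₀)
  · rw [hx.2]; exact hmax y hy

theorem mem_face_of_add {F : Set (SetFn n)} (hne : F.Nonempty) (hF : IsExposed ℝ (Gam n) F)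
    {x y : SetFn n} (hx : x ∈ Gam n) (hy : y ∈ Gam n) (hxy : x + y ∈ F) : x ∈ F ∧ y ∈ F := by
  obtain ⟨l, hl, hmem⟩ := exists_functional_of_face hne hF
  have h := ((hmem _).1 hxy).2
  rw [map_add] at h
  have a := hl x hx
  have b := hl y hy
  exact ⟨(hmem x).2 ⟨hx, by linarith⟩, (hmem y).2 ⟨hy, by linarith⟩⟩

end Faces

/-! ### Circuits -/

section Circuits

variable {n : ℕ} {r : SetFn n}

/-- `C` is a circuit of the matroid with rank function `r`. -/
structure IsRankCircuit (r : SetFn n) (C : Finset (Fin n)) : Prop where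
  rank_add_one : r C + 1 = C.card
  rank_eq_card : ∀ D ⊂ C, r D = D.card

namespace IsMatroidRank

theorem rank_empty (hr : IsMatroidRank r) : r ∅ = 0 := hr.1.1

theorem mono (hr : IsMatroidRank r) {A B : Finset (Fin n)} (h : A ⊆ B) : r A ≤ r B :=
  hr.1.2.2.1 A B h

theorem add_one_le (hr : IsMatroidRank r) {A B : Finset (Fin n)} (h : r A < r B) :
    r A + 1 ≤ r B := by
  obtain ⟨k, hk⟩ := hr.2.1 A
  obtain ⟨m, hm⟩ := hr.2.1 B
  rw [hk, hm] at h ⊢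
  exact_mod_cast h

theorem union_le (hr : IsMatroidRank r) (A B : Finset (Fin n)) : r (A ∪ B) ≤ r A + r B := by
  have := hr.1.2.2.2 A B
  have := hr.1.2.1 (A ∩ B)
  linarith

theorem singleton_le_one (hr : IsMatroidRank r) (x : Fin n) : r {x} ≤ 1 := by
  simpa using hr.2.2 {x}

theorem singleton_eq_one (hr : IsMatroidRank r) {x : Fin n} (hx : r {x} ≠ 0) : r {x} = 1 := by
  have h0 : r ∅ < r {x} := by
    rw [hr.rank_empty]; exact lt_of_le_of_ne (hr.1.2.1 _) (Ne.symm hx)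
  have := hr.add_one_le h0
  rw [hr.rank_empty] at this
  linarith [hr.singleton_le_one x]

theorem insert_le (hr : IsMatroidRank r) (x : Fin n) (A : Finset (Fin n)) :
    r (insert x A) ≤ r A + 1 := by
  have := hr.union_le {x} A
  rw [← Finset.insert_eq] at this
  linarith [hr.singleton_le_one x]

/-- The marginal ranks decrease. -/
theorem insert_add_le (hr : IsMatroidRank r) {A B : Finset (Fin n)} (h : A ⊆ B) {x : Fin n}
    (hx : x ∉ B) : r (insert x B) + r A ≤ r (insert x A) + r B := by
  have := hr.1.2.2.2 (insert x A) B
  have e1 : insert x A ∩ B = A := by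
    rw [Finset.insert_inter_of_notMem hx, Finset.inter_eq_left.2 h]
  have e2 : insert x A ∪ B = insert x B := by
    rw [Finset.insert_union, Finset.union_eq_right.2 h]
  rw [e1, e2] at this
  linarith

theorem insert_eq_of_subset (hr : IsMatroidRank r) {A B : Finset (Fin n)} (h : A ⊆ B) {x : Fin n}
    (hx : r (insert x A) = r A) : r (insert x B) = r B := by
  by_cases hB : x ∈ B
  · rw [Finset.insert_eq_of_mem hB]
  · have := hr.insert_add_le h hB
    exact le_antisymm (by linarith) (hr.mono (Finset.subset_insert x B))

theorem union_eq_of_forall (hr : IsMatroidRank r) {A B : Finset (Fin n)}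
    (h : ∀ x ∈ B, r (insert x A) = r A) : r (A ∪ B) = r A := by
  induction B using Finset.induction_on with
  | empty => simp
  | insert x B hx ih =>
    rw [Finset.union_insert, hr.insert_eq_of_subset Finset.subset_union_left
      (h x (Finset.mem_insert_self x B)), ih fun y hy => h y (Finset.mem_insert_of_mem hy)]

theorem eq_zero_of_loops (hr : IsMatroidRank r) {A : Finset (Fin n)} (h : ∀ i ∈ A, r {i} = 0) :
    r A = 0 := by
  have := hr.union_eq_of_forall (A := ∅) (B := A) fun x hx => by
    simpa [hr.rank_empty] using h x hx
  simpa [hr.rank_empty] using this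

theorem card_of_subset (hr : IsMatroidRank r) {A B : Finset (Fin n)} (hA : r A = A.card)
    (hB : B ⊆ A) : r B = B.card := by
  have h1 := hr.union_le B (A \ B)
  rw [Finset.union_sdiff_of_subset hB, hA] at h1
  have h2 := hr.2.2 (A \ B)
  have h3 := Finset.card_sdiff_add_card_eq_card hB
  have h4 : ((A \ B).card : ℝ) + B.card = A.card := by exact_mod_cast h3
  exact le_antisymm (hr.2.2 B) (by linarith)

/-- An element that raises the rank of all the others raises the rank of any smaller set at least as
much, and by integrality at least by one. -/
theorem card_of_erase_lt (hr : IsMatroidRank r) {A : Finset (Fin n)}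
    (h : ∀ x ∈ A, r (A.erase x) < r A) : r A = A.card := by
  refine le_antisymm (hr.2.2 A) ?_
  suffices ∀ B ⊆ A, (B.card : ℝ) ≤ r B from this A le_rfl
  intro B
  induction B using Finset.induction_on with
  | empty => intro _; simp [hr.rank_empty]
  | insert x B hx ih =>
    intro hB
    obtain ⟨hxA, hBA⟩ := Finset.insert_subset_iff.1 hB
    have h1 := ih hBA
    have h2 := hr.insert_add_le (A := B) (B := A.erase x) (x := x)
      (Finset.subset_erase.2 ⟨hBA, hx⟩) (Finset.notMem_erase x A)
    rw [Finset.insert_erase hxA] at h2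
    have h3 := hr.add_one_le (h x hxA)
    rw [Finset.card_insert_of_notMem hx]
    push_cast
    linarith

/-- Take a smallest `A ⊆ B` whose closure contains `j`; minimality makes `A` independent and lets
`j` be exchanged for any element of `A`. -/
theorem exists_circuit (hr : IsMatroidRank r) {j : Fin n} {B : Finset (Fin n)} (hj : j ∉ B)
    (hB : r (insert j B) = r B) :
    ∃ A ⊆ B, IsRankCircuit r (insert j A) := by
  classical
  obtain ⟨A, hA, hmin⟩ := Finset.exists_min_image
    (B.powerset.filter fun A => r (insert j A) = r A) Finset.card
    ⟨B, by simp [hB]⟩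
  rw [Finset.mem_filter, Finset.mem_powerset] at hA
  obtain ⟨hAB, hAr⟩ := hA
  have hjA : j ∉ A := fun h => hj (hAB h)
  have herase : ∀ x ∈ A, r (A.erase x) < r (insert j (A.erase x)) := by
    intro x hx
    refine lt_of_le_of_ne (hr.mono (Finset.subset_insert _ _)) fun h => ?_
    have := hmin (A.erase x) (Finset.mem_filter.2
      ⟨Finset.mem_powerset.2 ((Finset.erase_subset x A).trans hAB), h.symm⟩)
    exact absurd (Finset.card_erase_lt_of_mem hx) (not_lt.2 this)
  have hAi : r A = A.card := hr.card_of_erase_lt fun x hx =>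
    (herase x hx).trans_le (hAr ▸ hr.mono (Finset.insert_subset_insert j (Finset.erase_subset x A)))
  refine ⟨A, hAB, ?_, fun D hD => ?_⟩
  · rw [hAr, hAi, Finset.card_insert_of_notMem hjA]; push_cast; ring
  · obtain ⟨hDs, hne⟩ := Finset.ssubset_iff_subset_ne.1 hD
    obtain ⟨y, hy, hyD⟩ : ∃ y ∈ insert j A, y ∉ D := by
      by_contra hcon
      push Not at hcon
      exact hne (Finset.Subset.antisymm hDs hcon)
    have hDe : D ⊆ (insert j A).erase y := Finset.subset_erase.2 ⟨hDs, hyD⟩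
    refine hr.card_of_subset ?_ hDe
    rcases Finset.mem_insert.1 hy with rfl | hyA
    · rw [Finset.erase_insert hjA, hAi]
    · have hyj : y ≠ j := fun h => hjA (h ▸ hyA)
      rw [Finset.erase_insert_of_ne hyj.symm]
      refine le_antisymm (hr.2.2 _) ?_
      have h1 := hr.add_one_le (herase y hyA)
      rw [hr.card_of_subset hAi (Finset.erase_subset y A)] at h1
      rw [Finset.card_insert_of_notMem fun h => hjA (Finset.mem_of_mem_erase h)]
      push_cast
      exact h1

/-- A matroid whose rank function spans an extreme ray is connected up to loops. -/
theorem compl_eq_zero_of_separator (hr : IsMatroidRank r) (hray : SpansExtremeRay r)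
    {L : Finset (Fin n)} (hL : r L ≠ 0) (hsep : r L + r Lᶜ ≤ r Finset.univ) : r Lᶜ = 0 := by
  have hsum : (fun A => r (A ∩ L)) + (fun A => r (A ∩ Lᶜ)) = r := by
    funext A
    refine le_antisymm ?_ ?_
    · have h1 := hr.1.2.2.2 A L
      have h2 := hr.1.2.2.2 (A ∪ L) Lᶜ
      have e1 : (A ∪ L) ∩ Lᶜ = A ∩ Lᶜ := by
        rw [Finset.union_inter_distrib_right, Finset.inter_compl, Finset.union_empty]
      have e2 : A ∪ L ∪ Lᶜ = Finset.univ := by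
        rw [Finset.union_assoc, Finset.union_compl, Finset.union_eq_right.2 (Finset.subset_univ A)]
      rw [e1, e2] at h2
      simp only [Pi.add_apply]
      linarith
    · have := hr.union_le (A ∩ L) (A ∩ Lᶜ)
      rwa [← Finset.inter_union_distrib_left, Finset.union_compl, Finset.inter_univ] at this
  have hmem : r ∈ {h : SetFn n | ∃ t : ℝ, 0 ≤ t ∧ h = t • r} := ⟨1, zero_le_one, by simp⟩
  -- The rank is the sum of its restrictions to `L` and `Lᶜ`, so extremality makes the first one `t
  -- • r`. Evaluation at `L` gives `t = 1`, and at `Lᶜ` it gives the claim.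
  obtain ⟨t, -, ht⟩ := (mem_face_of_add hray.1 hray.2.1 (restrict_mem_Gam hr.1 L)
    (restrict_mem_Gam hr.1 Lᶜ) (hsum.symm ▸ hmem)).1
  have h1 := congrFun ht L
  have h2 := congrFun ht Lᶜ
  simp only [Finset.inter_self, Pi.smul_apply, smul_eq_mul] at h1
  have h3 : t = 1 := by
    have : (t - 1) * r L = 0 := by linarith
    rcases mul_eq_zero.1 this with h | h
    · linarith
    · exact absurd h hL
  simp only [Pi.smul_apply, smul_eq_mul, h3, one_mul] at h2
  rw [← h2, Finset.inter_comm, Finset.inter_compl, hr.rank_empty]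

/-- Every nonloop of a connected matroid of rank at least two is in a circuit with at least three
elements. -/
theorem exists_circuit_mem (hr : IsMatroidRank r) (hray : SpansExtremeRay r)
    (hrank : 2 ≤ r Finset.univ) {j : Fin n} (hj : r {j} ≠ 0) :
    ∃ C, IsRankCircuit r C ∧ j ∈ C ∧ 3 ≤ C.card := by
  classical
  -- `L` consists of the parallel class of `j` and the loops. Since `L` cannot be a separator, `Lᶜ`
  -- has full rank, and a circuit through `j` inside `Lᶜ ∪ {j}` has no element parallel to `j`.
  set L : Finset (Fin n) := Finset.univ.filter fun x => r {x, j} = r {j} with hLdef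
  have hj1 := hr.singleton_eq_one hj
  have hjL : j ∈ L := by simp [hLdef]
  have hL : r L = 1 := by
    have := hr.union_eq_of_forall (A := {j}) (B := L) fun x hx => (Finset.mem_filter.1 hx).2
    rwa [Finset.union_eq_right.2 (Finset.singleton_subset_iff.2 hjL), hj1] at this
  have hLc : r Lᶜ = r Finset.univ := by
    refine le_antisymm (hr.mono (Finset.subset_univ _)) ?_
    by_contra hlt
    have h1 := hr.add_one_le (not_le.1 hlt)
    have h2 := hr.compl_eq_zero_of_separator hray (L := L) (by rw [hL]; exact one_ne_zero)
      (by linarith)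
    have h3 := hr.union_le L Lᶜ
    rw [Finset.union_compl] at h3
    linarith
  have hjc : j ∉ Lᶜ := by simpa using hjL
  obtain ⟨A, hA, hC⟩ := hr.exists_circuit hjc
    (le_antisymm (hLc.symm ▸ hr.mono (Finset.subset_univ _)) (hr.mono (Finset.subset_insert _ _)))
  have hjA : j ∉ A := fun h => hjc (hA h)
  refine ⟨_, hC, Finset.mem_insert_self _ _, ?_⟩
  rw [Finset.card_insert_of_notMem hjA]
  have h0 : A.card ≠ 0 := by
    intro h0
    have := hC.rank_add_one
    rw [Finset.card_eq_zero.1 h0] at this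
    simp [hj1] at this
  have h1 : A.card ≠ 1 := by
    intro h1
    obtain ⟨x, rfl⟩ := Finset.card_eq_one.1 h1
    have h2 := hC.rank_add_one
    rw [Finset.card_insert_of_notMem hjA, Finset.card_singleton] at h2
    have hxL : x ∈ L := by
      refine Finset.mem_filter.2 ⟨Finset.mem_univ _, ?_⟩
      rw [Finset.pair_comm, hj1]
      push_cast at h2
      linarith
    exact absurd hxL (Finset.mem_compl.1 (hA (Finset.mem_singleton_self x)))
  omega

end IsMatroidRank

end Circuits

/-! ### What an entropic point forces on circuits and common parts -/

section EntropicFaces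

variable {n : ℕ} {r : SetFn n}

theorem uniformRank_one_of_mem {β A : Finset (Fin n)} {i : Fin n} (hA : i ∈ A) (hβ : i ∈ β) :
    uniformRank 1 β A = 1 := by
  rw [uniformRank_one, if_pos ⟨i, hA, hβ⟩]

theorem uniformRank_one_of_forall {β A : Finset (Fin n)} (h : ∀ i ∈ A, i ∉ β) :
    uniformRank 1 β A = 0 := by
  rw [uniformRank_one, if_neg fun ⟨i, hA, hβ⟩ => h i hA hβ]

theorem uniformRank_one_insert {β A : Finset (Fin n)} {x : Fin n} (hx : x ∉ β) :
    uniformRank 1 β (insert x A) = uniformRank 1 β A := by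
  rw [uniformRank, Finset.insert_inter_of_notMem hx, uniformRank]

section Partition

variable {Ω : Type*} [Fintype Ω] {p : Ω → ℝ} {S : Fin n → Setoid Ω}

theorem nonempty_of_sum_eq_one (h1 : ∑ ω, p ω = 1) : Nonempty Ω := by
  by_contra h
  rw [not_nonempty_iff] at h
  simp at h1

theorem inf_le_of_entFn_le (hp : ∀ ω, 0 < p ω) {A B : Finset (Fin n)} (hAB : A ⊆ B)
    (h : entFn p S B ≤ entFn p S A) : A.inf S ≤ B.inf S :=
  le_of_ent_le hp (Finset.inf_mono hAB) h

theorem condIndep_of_entFn {A B K : Finset (Fin n)} (hA : K ⊆ A) (hB : K ⊆ B)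
    (h : entFn p S A + entFn p S B ≤ entFn p S (A ∪ B) + entFn p S K) :
    CondIndep p (A.inf S) (B.inf S) (K.inf S) :=
  ⟨Finset.inf_mono hA, Finset.inf_mono hB, by rw [← Finset.inf_union]; exact h⟩

end Partition

/-- A circuit in which the additional randomness of `U_{1,α}` does not interfere forces the
entropy of an element outside `α` to be that of a uniform distribution. -/
theorem IsRankCircuit.exists_eq_log_nat {C α : Finset (Fin n)} {a b : ℝ}
    (hC : IsRankCircuit r C) (h : a • r + b • uniformRank 1 α ∈ GamStar n)
    {f g e : Fin n} (hf : f ∈ C) (hg : g ∈ C) (he : e ∈ C) (hfg : f ≠ g) (hfe : f ≠ e)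
    (hge : g ≠ e) (hfα : f ∉ α) (hα : g ∉ α ∨ ∃ k ∈ C, k ∈ α ∧ k ≠ g ∧ k ≠ e) :
    ∃ N : ℕ, 0 < N ∧ a = Real.log N := by
  obtain ⟨Ω, _, p, S, hp, h1, hS⟩ := exists_entFn_of_mem_GamStar h
  have := nonempty_of_sum_eq_one h1
  set K : Finset (Fin n) := ((C.erase f).erase g).erase e with hK
  set u : SetFn n := uniformRank 1 α with hu
  have hval : ∀ A, entFn p S A = a * r A + b * u A := fun A => by rw [← hS]; rfl
  have heK : e ∉ K := Finset.notMem_erase _ _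
  have hgK : g ∉ insert e K := by simp [hK, hge]
  have hfK : f ∉ insert g (insert e K) := by simp [hK, hfg, hfe]
  have hCeq : insert f (insert g (insert e K)) = C := by
    rw [hK, Finset.insert_erase (by simp [he, hge.symm, hfe.symm]),
      Finset.insert_erase (by simp [hg, hfg.symm]), Finset.insert_erase hf]
  have hgK' : g ∉ K := fun h => hgK (Finset.mem_insert_of_mem h)
  have hfgK : f ∉ insert g K := fun h =>
    hfK (Finset.insert_subset_insert g (Finset.subset_insert e K) h)
  have hfeK : f ∉ insert e K := fun h => hfK (Finset.mem_insert_of_mem h)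
  have hfK' : f ∉ K := fun h => hfeK (Finset.mem_insert_of_mem h)
  have hcC : (C.card : ℝ) = K.card + 3 := by
    rw [← hCeq, Finset.card_insert_of_notMem hfK, Finset.card_insert_of_notMem hgK,
      Finset.card_insert_of_notMem heK]
    push_cast; ring
  have hrC : r C = K.card + 2 := by linarith [hC.rank_add_one]
  have hss : ∀ {D : Finset (Fin n)}, ∀ x ∈ C, x ∉ D → D ⊆ C → r D = D.card := fun x hx hxD hD =>
    hC.rank_eq_card _ (Finset.ssubset_iff_subset_ne.2 ⟨hD, fun h => hxD (h ▸ hx)⟩)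
  have hKC : K ⊆ C :=
    (Finset.erase_subset _ _).trans ((Finset.erase_subset _ _).trans (Finset.erase_subset _ _))
  have hfC : insert f K ⊆ C := Finset.insert_subset hf hKC
  have hgC : insert g K ⊆ C := Finset.insert_subset hg hKC
  have heC : insert e K ⊆ C := Finset.insert_subset he hKC
  have rK : r K = K.card := hss f hf hfK' hKC
  have rf : r (insert f K) = K.card + 1 := by
    rw [hss g hg (by simp [hfg.symm, hgK']) hfC, Finset.card_insert_of_notMem hfK']; simp
  have rg : r (insert g K) = K.card + 1 := by
    rw [hss f hf hfgK hgC, Finset.card_insert_of_notMem hgK']; simp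
  have re : r (insert e K) = K.card + 1 := by
    rw [hss f hf hfeK heC, Finset.card_insert_of_notMem heK]; simp
  have rfg : r (insert f (insert g K)) = K.card + 2 := by
    rw [hss e he (by simp [hge.symm, hfe.symm, heK]) (Finset.insert_subset hf hgC),
      Finset.card_insert_of_notMem hfgK, Finset.card_insert_of_notMem hgK']
    push_cast; ring
  have rfe : r (insert f (insert e K)) = K.card + 2 := by
    rw [hss g hg (by simp [hge, hfg.symm, hgK']) (Finset.insert_subset hf heC),
      Finset.card_insert_of_notMem hfeK, Finset.card_insert_of_notMem heK]
    push_cast; ring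
  have rge : r (insert g (insert e K)) = K.card + 2 := by
    rw [hss f hf hfK (Finset.insert_subset hg heC),
      Finset.card_insert_of_notMem hgK, Finset.card_insert_of_notMem heK]
    push_cast; ring
  have rf1 : r {f} = 1 := by
    rw [hss g hg (by simp [hfg.symm]) (Finset.singleton_subset_iff.2 hf)]; simp
  have uf1 : u {f} = 0 := uniformRank_one_of_forall (by simpa using hfα)
  have uf : ∀ A, u (insert f A) = u A := fun A => uniformRank_one_insert hfα
  -- Adding `g` brings no new share of `b`: either `g` is outside `α`, or `K` already meets `α`. The
  -- element `e` may bring one.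
  have ug : u (insert g K) = u K ∧ u (insert g (insert e K)) = u (insert e K) := by
    rcases hα with hgα | ⟨k, hkC, hkα, hkg, hke⟩
    · exact ⟨uniformRank_one_insert hgα, uniformRank_one_insert hgα⟩
    · have hk : k ∈ K := by
        have hkf : k ≠ f := fun h => hfα (h ▸ hkα)
        simp [hK, hkC, hkg, hke, hkf]
      simp only [hu]
      rw [uniformRank_one_of_mem hk hkα, uniformRank_one_of_mem (Finset.mem_insert_of_mem hk) hkα,
        uniformRank_one_of_mem (Finset.mem_insert_of_mem hk) hkα, uniformRank_one_of_mem
          (Finset.mem_insert_of_mem (Finset.mem_insert_of_mem hk)) hkα]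
      exact ⟨rfl, rfl⟩
  have hun : ∀ x y : Fin n, insert x K ∪ insert y K = insert x (insert y K) := fun x y => by
    ext z; simp only [Finset.mem_union, Finset.mem_insert]; tauto
  have hfinf : (insert f K).inf S = S f ⊓ K.inf S := Finset.inf_insert
  have hsub : ∀ x : Fin n, K ⊆ insert x K := fun x => Finset.subset_insert x K
  -- Given `K`, any two of `f`, `g`, `e` are independent. Adjoining `g` to `f, e, K`, or `f` to `g,
  -- e, K`, changes neither the rank nor the `b`-term, whence the functional dependences.
  obtain ⟨N, hN, hNe⟩ := exists_ent_eq_log_nat hp h1 (f := S f) (k := K.inf S)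
    (G := (insert g K).inf S) (E := (insert e K).inf S)
    (hfinf ▸ condIndep_of_entFn (hsub f) (hsub g) (by
      rw [hun]; simp only [hval, rf, rg, rfg, rK, uf, ug]; linarith))
    (hfinf ▸ condIndep_of_entFn (hsub f) (hsub e) (by
      rw [hun]; simp only [hval, rf, re, rfe, rK, uf]; linarith))
    (condIndep_of_entFn (hsub g) (hsub e) (by
      rw [hun]; simp only [hval, rg, re, rge, rK, ug]; linarith))
    (by
      rw [← hfinf, ← Finset.inf_union, hun]
      refine (inf_le_of_entFn_le hp (B := C) (Finset.insert_subset hf heC) ?_).trans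
        (Finset.inf_mono hgC)
      rw [hval, hval, hrC, rfe, ← hCeq, uf, uf, ug.2])
    (by
      rw [← hfinf, ← Finset.inf_union, hun]
      refine (inf_le_of_entFn_le hp (B := C) (Finset.insert_subset hg heC) ?_).trans
        (Finset.inf_mono hfC)
      rw [hval, hval, hrC, rge, ← hCeq, uf])
    ⟨le_top, le_top, by
      have e1 : ent p (S f) = entFn p S {f} := by rw [entFn, Finset.inf_singleton]
      have e2 : ent p (K.inf S) = entFn p S K := rfl
      have e3 : ent p ((insert f K).inf S) = entFn p S (insert f K) := rfl
      rw [ent_top h1, ← hfinf, e1, e2, e3, hval, hval, hval, rf1, uf1, rK, rf, uf]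
      linarith⟩
  refine ⟨N, hN, ?_⟩
  rw [← hNe, show ent p (S f) = entFn p S {f} by rw [entFn, Finset.inf_singleton], hval, rf1, uf1]
  ring

/-- The positive multiples of a connected matroid of rank at least two that are entropic. -/
theorem exists_mem_charSet (hr : IsMatroidRank r) (hray : SpansExtremeRay r)
    (hrank : 2 ≤ r Finset.univ) {t : ℝ} (ht : 0 < t) (h : t • r ∈ GamStar n) :
    (charSet r).Nonempty := by
  obtain ⟨j, hj⟩ : ∃ j, r {j} ≠ 0 := by
    by_contra hcon
    push Not at hcon
    linarith [hr.eq_zero_of_loops (A := Finset.univ) fun i _ => hcon i]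
  obtain ⟨C, hC, hjC, hcard⟩ := hr.exists_circuit_mem hray hrank hj
  have hcard' : 1 < (C.erase j).card := by rw [Finset.card_erase_of_mem hjC]; omega
  obtain ⟨g, hg, e, he, hge⟩ := Finset.one_lt_card.1 hcard'
  obtain ⟨hgj, hgC⟩ := Finset.mem_erase.1 hg
  obtain ⟨hej, heC⟩ := Finset.mem_erase.1 he
  obtain ⟨N, hN, rfl⟩ := hC.exists_eq_log_nat (α := ∅) (a := t) (b := 0) (by simpa using h)
    hjC hgC heC hgj.symm hej.symm hge (by simp) (Or.inl (by simp))
  refine ⟨N, ?_, by simpa using h⟩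
  have h1 : (1 : ℝ) < N := by
    by_contra hcon
    exact absurd ht (not_lt.2 (Real.log_nonpos (Nat.cast_nonneg N) (not_lt.1 hcon)))
  have h2 : 1 < N := by exact_mod_cast h1
  exact_mod_cast h2

section CommonPart

variable {Ω : Type} [Fintype Ω] {p : Ω → ℝ} {S : Fin n → Setoid Ω} {α : Finset (Fin n)} {a b : ℝ}

theorem ent_singleton_eq_of_mem (hS : a • r + b • uniformRank 1 α = entFn p S) {x : Fin n}
    (hx : x ∈ α) : ent p (S x) = a * r {x} + b := by
  have : ent p (S x) = entFn p S {x} := by rw [entFn, Finset.inf_singleton]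
  rw [this, ← hS]
  simp [uniformRank_one_of_mem (Finset.mem_singleton_self x) hx]

theorem ent_inf_pair (hS : a • r + b • uniformRank 1 α = entFn p S) {x y : Fin n}
    (hy : y ∈ α) : ent p (S x ⊓ S y) = a * r {x, y} + b := by
  have : ent p (S x ⊓ S y) = entFn p S {x, y} := by
    rw [entFn, Finset.inf_insert, Finset.inf_singleton]
  rw [this, ← hS]
  simp [uniformRank_one_of_mem (show y ∈ ({x, y} : Finset (Fin n)) by simp) hy]

theorem ent_inf_triple (hS : a • r + b • uniformRank 1 α = entFn p S) {x y z : Fin n}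
    (hz : z ∈ α) : ent p (S x ⊓ (S y ⊓ S z)) = a * r {x, y, z} + b := by
  have : ent p (S x ⊓ (S y ⊓ S z)) = entFn p S {x, y, z} := by
    rw [entFn, Finset.inf_insert, Finset.inf_insert, Finset.inf_singleton]
  rw [this, ← hS]
  simp [uniformRank_one_of_mem (show z ∈ ({x, y, z} : Finset (Fin n)) by simp) hz]

/-- For independent `x`, `y`, `z` in `α`, the common part of `x` and `y` has entropy `b` and is a
function of `z`. -/
theorem common_part_of_indep (hp : ∀ ω, 0 < p ω) (h1 : ∑ ω, p ω = 1)
    (hS : a • r + b • uniformRank 1 α = entFn p S) {x y z : Fin n} (hx : x ∈ α) (hy : y ∈ α)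
    (hz : z ∈ α) (rx : r {x} = 1) (ry : r {y} = 1) (rz : r {z} = 1) (rxy : r {x, y} = 2)
    (rzx : r {z, x} = 2) (rzy : r {z, y} = 2) (rzxy : r {z, x, y} = 3) :
    ent p (S x ⊔ S y) = b ∧ S z ≤ S x ⊔ S y := by
  have ex := ent_singleton_eq_of_mem hS hx
  have ey := ent_singleton_eq_of_mem hS hy
  have ez := ent_singleton_eq_of_mem hS hz
  have exy := ent_inf_pair hS (x := x) hy
  have ezx := ent_inf_pair hS (x := z) hx
  have ezy := ent_inf_pair hS (x := z) hy
  have ezxy := ent_inf_triple hS (x := z) (y := x) hy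
  rw [rx] at ex; rw [ry] at ey; rw [rz] at ez; rw [rxy] at exy; rw [rzx] at ezx
  rw [rzy] at ezy; rw [rzxy] at ezxy
  have hc : CondIndep p (S z ⊓ S y) (S x ⊓ S y) (S y) := ⟨inf_le_right, inf_le_right, by
    rw [inf_inf_inf_comm, inf_idem, inf_assoc, ezxy, ezy, exy, ey]; linarith⟩
  have hb : CondIndep p (S z ⊓ S x) (S y ⊓ S x) (S x) := ⟨inf_le_right, inf_le_right, by
    rw [inf_inf_inf_comm, inf_idem, inf_assoc, inf_comm (S y) (S x), ezxy, ezx, exy, ex]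
    linarith⟩
  -- Write `J` for `S x ⊔ S y`. The double Markov property gives `H(z, J) = a + H(J)`. As `H(z, J) ≥
  -- H(z) = a + b`, one gets `H(J) ≥ b`; submodularity of `x` and `y` over `J` gives `H(J) ≤ b`.
  -- Then `H(z, J) = H(z)`, so `z` determines `J`.
  have hsup := ent_inf_sup hp h1 hc hb
  rw [ezxy, exy] at hsup
  have h2 := ent_anti hp (inf_le_left : S z ⊓ (S x ⊔ S y) ≤ S z)
  have h3 := ent_submodular hp h1 (le_sup_left : S x ≤ S x ⊔ S y) le_sup_right
  refine ⟨by linarith, ?_⟩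
  refine le_of_ent_inf_le hp (s := S x ⊔ S y) ?_
  rw [inf_comm]
  linarith

/-- If elements `x`, `y` of `α` have a common part of entropy at least `b`, and `f` is outside `α`
on the line through `x` and `y`, then `f` is uniform. -/
theorem exists_eq_log_nat_of_common (hp : ∀ ω, 0 < p ω) (h1 : ∑ ω, p ω = 1)
    (hS : a • r + b • uniformRank 1 α = entFn p S) {f x y : Fin n} (hf : f ∉ α) (hx : x ∈ α)
    (hy : y ∈ α) (rf : r {f} = 1) (rx : r {x} = 1) (ry : r {y} = 1) (rfx : r {f, x} = 2)
    (rfy : r {f, y} = 2) (rxy : r {x, y} = 2) (rfxy : r {f, x, y} = 2) {Z : Setoid Ω}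
    (hxZ : S x ≤ Z) (hyZ : S y ≤ Z) (hZ : b ≤ ent p Z) :
    ∃ N : ℕ, 0 < N ∧ a = Real.log N := by
  have := nonempty_of_sum_eq_one h1
  have ef : ent p (S f) = a := by
    have : ent p (S f) = entFn p S {f} := by rw [entFn, Finset.inf_singleton]
    rw [this, ← hS]
    simp [uniformRank_one_of_forall (β := α) (A := {f}) (by simpa using hf), rf]
  have ex := ent_singleton_eq_of_mem hS hx
  have ey := ent_singleton_eq_of_mem hS hy
  have efx := ent_inf_pair hS (x := f) hx
  have efy := ent_inf_pair hS (x := f) hy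
  have exy := ent_inf_pair hS (x := x) hy
  have efxy := ent_inf_triple hS (x := f) (y := x) hy
  rw [rx] at ex; rw [ry] at ey; rw [rfx] at efx; rw [rfy] at efy; rw [rxy] at exy
  rw [rfxy] at efxy
  have hfZx : S f ⊓ Z ⊓ S x = S f ⊓ S x := by rw [inf_assoc, inf_eq_right.2 hxZ]
  have hfZy : S f ⊓ Z ⊓ S y = S f ⊓ S y := by rw [inf_assoc, inf_eq_right.2 hyZ]
  have hfZ : ent p (S f ⊓ Z) ≤ a + ent p Z := by
    have := ent_submodular hp h1 (le_top : S f ≤ ⊤) (le_top : Z ≤ ⊤)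
    rw [ent_top h1, ef] at this
    linarith
  -- `f` is independent of `x`, hence of the function `Z` of `x`.
  have hfZ' : a + ent p Z ≤ ent p (S f ⊓ Z) := by
    have := ent_submodular hp h1 (inf_le_right : S f ⊓ Z ≤ Z) hxZ
    rw [hfZx, efx, ex] at this
    linarith
  obtain ⟨N, hN, hNe⟩ := exists_ent_eq_log_nat hp h1 (f := S f) (k := Z) (G := S x) (E := S y)
    ⟨inf_le_right, hxZ, by rw [hfZx, efx, ex]; linarith⟩
    ⟨inf_le_right, hyZ, by rw [hfZy, efy, ey]; linarith⟩
    ⟨hxZ, hyZ, by rw [exy, ex, ey]; linarith⟩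
    (by
      rw [hfZy]
      refine (le_of_ent_le hp (s := S f ⊓ (S x ⊓ S y)) (inf_le_inf le_rfl inf_le_right) ?_).trans
        (inf_le_right.trans inf_le_left)
      rw [efxy, efy])
    (le_inf ((le_of_ent_inf_le hp (s := S f) (by rw [efxy, exy]))) (inf_le_left.trans hxZ))
    ⟨le_top, le_top, by rw [ent_top h1, ef]; linarith⟩
  exact ⟨N, hN, by rw [← hNe, ef]⟩

open Classical in
/-- If all nonloops are in `α` and the elements of `α` share a common part of entropy `b`, then
`r` itself has an entropic multiple. -/
theorem charSet_nonempty_of_common (hr : IsMatroidRank r) (hray : SpansExtremeRay r)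
    (hrank : 2 ≤ r Finset.univ) (hp : ∀ ω, 0 < p ω) (h1 : ∑ ω, p ω = 1)
    (hS : a • r + b • uniformRank 1 α = entFn p S) (ha : 0 < a) (hloop : ∀ i ∉ α, r {i} = 0)
    {Z : Setoid Ω} (hZα : ∀ i ∈ α, S i ≤ Z) (hZ : ent p Z = b) : (charSet r).Nonempty := by
  have hval : ∀ A, entFn p S A = a * r A + b * uniformRank 1 α A := fun A => by rw [← hS]; rfl
  -- Conditioning on `Z` removes exactly the `b`-term: a set meeting `α` determines `Z`, and a set
  -- missing `α` consists of loops and is constant.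
  have hcond : ∀ A, ent p (A.inf S ⊓ Z) - ent p Z = a * r A := by
    intro A
    by_cases hA : ∃ i ∈ A, i ∈ α
    · obtain ⟨i, hiA, hiα⟩ := hA
      rw [inf_eq_left.2 ((Finset.inf_le hiA).trans (hZα i hiα)), hZ]
      have := hval A
      rw [uniformRank_one_of_mem hiA hiα, entFn] at this
      linarith
    · have hA' : ∀ i ∈ A, i ∉ α := fun i hi hiα => hA ⟨i, hi, hiα⟩
      have hrA := hr.eq_zero_of_loops fun i hi => hloop i (hA' i hi)
      have h0 := hval A
      rw [uniformRank_one_of_forall hA', hrA, entFn] at h0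
      have htop : ⊤ ≤ A.inf S := le_of_ent_le hp le_top (by rw [h0, ent_top h1]; linarith)
      rw [top_le_iff.1 htop, top_inf_eq, hrA]
      ring
  set H : Ω → SetFn n := fun ω₀ =>
    entFn (blockProb p Z ω₀) fun i => (S i).comap Subtype.val with hH
  have hinf : ∀ (ω₀ : Ω) (A : Finset (Fin n)),
      (A.inf fun i => (S i).comap (Subtype.val : {ω // Z ω ω₀} → Ω)) =
        (A.inf S).comap Subtype.val := by
    intro ω₀ A
    ext x y
    rw [finset_inf_rel, Setoid.comap_rel, finset_inf_rel]
    rfl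
  have hsum : ∑ ω₀, p ω₀ • H ω₀ = a • r := by
    funext A
    rw [Finset.sum_apply, Pi.smul_apply, smul_eq_mul, ← hcond A, ← sum_mul_ent_blockProb hp]
    refine Finset.sum_congr rfl fun ω₀ _ => ?_
    rw [Pi.smul_apply, smul_eq_mul, hH]
    simp only [entFn, hinf]
  have hHG : ∀ ω₀, H ω₀ ∈ Gam n := fun ω₀ =>
    entFn_mem_Gam (blockProb_pos hp Z ω₀) (sum_blockProb hp Z ω₀) _
  obtain ⟨l, hl, hmem⟩ := exists_functional_of_face hray.1 hray.2.1
  have hlr : l r = 0 := ((hmem r).1 ⟨1, zero_le_one, by simp⟩).2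
  have hl0 : ∑ ω₀, p ω₀ * l (H ω₀) = 0 := by
    have := congrArg l hsum
    rw [map_smul, hlr, map_sum] at this
    simpa using this
  -- The mean of the conditional entropy functions lies on the extreme ray, so the supporting
  -- functional vanishes at each of them and each lies on the ray.
  have hray' : ∀ ω₀, ∃ t : ℝ, 0 ≤ t ∧ H ω₀ = t • r := fun ω₀ => by
    have := (Finset.sum_eq_zero_iff_of_nonpos fun ω _ =>
      mul_nonpos_of_nonneg_of_nonpos (hp ω).le (hl _ (hHG ω))).1 hl0 ω₀ (Finset.mem_univ _)
    exact (hmem _).2 ⟨hHG ω₀, (mul_eq_zero.1 this).resolve_left (hp ω₀).ne'⟩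
  choose t ht0 ht using hray'
  obtain ⟨ω₀, hω₀⟩ : ∃ ω₀, 0 < t ω₀ := by
    by_contra hcon
    push Not at hcon
    have h2 := congrFun hsum Finset.univ
    rw [Finset.sum_eq_zero fun ω _ => by
      rw [ht, le_antisymm (hcon ω) (ht0 ω), zero_smul, smul_zero]] at h2
    have : 0 < a * r Finset.univ := by positivity
    exact absurd h2 this.ne
  refine exists_mem_charSet hr hray hrank hω₀ ?_
  rw [← ht]
  exact entFn_mem_GamStar ⟨fun ω => (blockProb_pos hp Z ω₀ ω).le, sum_blockProb hp Z ω₀⟩ _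

end CommonPart

end EntropicFaces

/-! ### Pairs, triples and three-element circuits -/

section MoreCircuits

variable {n : ℕ} {r : SetFn n}

namespace IsMatroidRank

theorem exists_insert_eq_add_one (hr : IsMatroidRank r) {A B : Finset (Fin n)}
    (h : r A < r B) : ∃ x ∈ B, r (insert x A) = r A + 1 := by
  by_contra hcon
  push Not at hcon
  have h2 := hr.union_eq_of_forall (A := A) (B := B) fun x hx => by
    by_contra hne
    exact hcon x hx (le_antisymm (hr.insert_le x A) (hr.add_one_le
      (lt_of_le_of_ne (hr.mono (Finset.subset_insert x A)) (Ne.symm hne))))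
  exact absurd (hr.mono (Finset.subset_union_right (s₁ := A) (s₂ := B))) (by rw [h2]; linarith)

theorem card_triple (hr : IsMatroidRank r) {x y z : Fin n} (h : r {x, y, z} = 3) :
    r {x, y, z} = ({x, y, z} : Finset (Fin n)).card := by
  refine le_antisymm (hr.2.2 _) ?_
  rw [h]
  exact_mod_cast Finset.card_le_three

theorem card_pair (hr : IsMatroidRank r) {x y : Fin n} (h : r {x, y} = 2) :
    r {x, y} = ({x, y} : Finset (Fin n)).card := by
  refine le_antisymm (hr.2.2 _) ?_
  rw [h]
  exact_mod_cast Finset.card_le_two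

theorem ne_of_pair (hr : IsMatroidRank r) {x y : Fin n} (h : r {x, y} = 2) : x ≠ y := by
  rintro rfl
  have := hr.singleton_le_one x
  simp only [Finset.pair_eq_singleton] at h
  linarith

theorem left_of_pair (hr : IsMatroidRank r) {x y : Fin n} (h : r {x, y} = 2) : r {x} = 1 := by
  simpa using hr.card_of_subset (hr.card_pair h) (B := {x}) (by simp)

theorem right_of_pair (hr : IsMatroidRank r) {x y : Fin n} (h : r {x, y} = 2) : r {y} = 1 := by
  simpa using hr.card_of_subset (hr.card_pair h) (B := {y}) (by simp)

theorem pairs_of_triple (hr : IsMatroidRank r) {x y z : Fin n} (h : r {x, y, z} = 3) :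
    r {x, y} = 2 ∧ r {x, z} = 2 ∧ r {y, z} = 2 := by
  have hc := hr.card_triple h
  have hc3 : ({x, y, z} : Finset (Fin n)).card = 3 := by rw [h] at hc; exact_mod_cast hc.symm
  obtain ⟨hxy, hxz, hyz⟩ : x ≠ y ∧ x ≠ z ∧ y ≠ z := by
    refine ⟨?_, ?_, ?_⟩ <;> rintro rfl
    · rw [Finset.insert_idem] at hc3
      exact absurd (Finset.card_le_two (a := x) (b := z)) (by omega)
    · rw [Finset.pair_comm, Finset.insert_idem] at hc3
      exact absurd (Finset.card_le_two (a := x) (b := y)) (by omega)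
    · rw [Finset.pair_eq_singleton] at hc3
      exact absurd (Finset.card_le_two (a := x) (b := y)) (by omega)
  refine ⟨?_, ?_, ?_⟩
  · rw [hr.card_of_subset hc (by intro a; simp; tauto), Finset.card_pair hxy]; rfl
  · rw [hr.card_of_subset hc (by intro a; simp; tauto), Finset.card_pair hxz]; rfl
  · rw [hr.card_of_subset hc (by intro a; simp; tauto), Finset.card_pair hyz]; rfl

/-- On a line, an element parallel to both of two elements makes them parallel. -/
theorem pair_or_pair (hr : IsMatroidRank r) {w x y : Fin n} (hw : r {w} = 1) (h : r {x, y} = 2) :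
    r {w, x} = 2 ∨ r {w, y} = 2 := by
  by_contra hcon
  push Not at hcon
  have key : ∀ z, r {w, z} ≠ 2 → r (insert z {w}) = r {w} := by
    intro z hz
    rw [Finset.pair_comm] at hz
    by_contra hne
    refine hz (le_antisymm ?_ ?_)
    · have := hr.insert_le z {w}; linarith
    · have := hr.add_one_le (lt_of_le_of_ne (hr.mono (Finset.subset_insert z {w})) (Ne.symm hne))
      linarith
  have h2 := hr.union_eq_of_forall (A := {w}) (B := {x, y}) (by
    intro z hz
    rcases Finset.mem_insert.1 hz with rfl | hz
    · exact key _ hcon.1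
    · rw [Finset.mem_singleton.1 hz]; exact key _ hcon.2)
  have := hr.mono (Finset.subset_union_right (s₁ := {w}) (s₂ := {x, y}))
  linarith

theorem isRankCircuit_triple (hr : IsMatroidRank r) {x y z : Fin n} (hxy : r {x, y} = 2)
    (hxz : r {x, z} = 2) (hyz : r {y, z} = 2) (h : r {x, y, z} = 2) :
    IsRankCircuit r {x, y, z} := by
  have nxy := hr.ne_of_pair hxy
  have nxz := hr.ne_of_pair hxz
  have nyz := hr.ne_of_pair hyz
  refine ⟨?_, fun D hD => ?_⟩
  · rw [h, Finset.card_eq_three.2 ⟨x, y, z, nxy, nxz, nyz, rfl⟩]; norm_num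
  · obtain ⟨w, hw, hwD⟩ := Finset.exists_of_ssubset hD
    have hDs := hD.1
    have key : ∀ A : Finset (Fin n), r A = A.card → D ⊆ A → r D = D.card := fun A hA h =>
      hr.card_of_subset hA h
    have hmem : ∀ a ∈ D, a = x ∨ a = y ∨ a = z := fun a ha => by simpa using hDs ha
    simp only [Finset.mem_insert, Finset.mem_singleton] at hw
    rcases hw with rfl | rfl | rfl
    · refine key _ (hr.card_pair hyz) fun a ha => ?_
      rcases hmem a ha with rfl | rfl | rfl
      · exact absurd ha hwD
      · simp
      · simp
    · refine key _ (hr.card_pair hxz) fun a ha => ?_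
      rcases hmem a ha with rfl | rfl | rfl
      · simp
      · exact absurd ha hwD
      · simp
    · refine key _ (hr.card_pair hxy) fun a ha => ?_
      rcases hmem a ha with rfl | rfl | rfl
      · simp
      · simp
      · exact absurd ha hwD

end IsMatroidRank

theorem IsRankCircuit.ranks_triple {x y z : Fin n} (h : IsRankCircuit r {x, y, z}) (hxy : x ≠ y)
    (hxz : x ≠ z) (hyz : y ≠ z) :
    r {x, y} = 2 ∧ r {x, z} = 2 ∧ r {y, z} = 2 ∧ r {x, y, z} = 2 := by
  have hc : ({x, y, z} : Finset (Fin n)).card = 3 :=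
    Finset.card_eq_three.2 ⟨x, y, z, hxy, hxz, hyz, rfl⟩
  have key : ∀ a b : Fin n, a ≠ b → ({a, b} : Finset (Fin n)) ⊆ {x, y, z} → r {a, b} = 2 := by
    intro a b hab hsub
    rw [h.rank_eq_card _ (Finset.ssubset_iff_subset_ne.2 ⟨hsub, fun he => ?_⟩),
      Finset.card_pair hab]
    · rfl
    · rw [← he, Finset.card_pair hab] at hc
      omega
  refine ⟨key _ _ hxy (by intro a; simp; tauto), key _ _ hxz (by intro a; simp; tauto),
    key _ _ hyz (by intro a; simp; tauto), ?_⟩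
  have := h.rank_add_one
  rw [hc] at this
  push_cast at this
  linarith

end MoreCircuits

/-! ### When `a` must be a logarithm, and when all or no points are entropic -/

section Classification

variable {n : ℕ} {r : SetFn n} {α : Finset (Fin n)}

/-- The entropic points `(a, b)` have the entropy `a` of a uniform distribution. -/
def LogIntegral (r : SetFn n) (α : Finset (Fin n)) : Prop :=
  ∀ a b : ℝ, 0 < a → 0 < b → a • r + b • uniformRank 1 α ∈ GamStar n →
    ∃ N : ℕ, 0 < N ∧ a = Real.log N

/-- In a circuit through `j` with at least three elements, a second element outside `α`, or a
further element of `α` left to condition on, makes `IsRankCircuit.exists_eq_log_nat` applicable.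
Only a three-element circuit whose other two elements are in `α` escapes. -/
theorem logIntegral_or_exists_triple (hr : IsMatroidRank r) (hray : SpansExtremeRay r)
    (hrank : 2 ≤ r Finset.univ) {j : Fin n} (hjα : j ∉ α) (hj : r {j} ≠ 0) :
    LogIntegral r α ∨ ∃ x ∈ α, ∃ y ∈ α,
      r {j, x} = 2 ∧ r {j, y} = 2 ∧ r {x, y} = 2 ∧ r {j, x, y} = 2 := by
  obtain ⟨C, hC, hjC, hcard⟩ := hr.exists_circuit_mem hray hrank hj
  have hce := Finset.card_erase_of_mem hjC
  by_cases hg : ∃ g ∈ C.erase j, g ∉ α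
  · left
    obtain ⟨g, hg, hgα⟩ := hg
    have hc2 := Finset.card_erase_of_mem hg
    obtain ⟨e, he⟩ : ((C.erase j).erase g).Nonempty := Finset.card_pos.1 (by omega)
    simp only [Finset.mem_erase] at hg he
    intro a b _ _ h
    exact hC.exists_eq_log_nat h hjC hg.2 he.2.2 hg.1.symm he.2.1.symm he.1.symm hjα (Or.inl hgα)
  · push Not at hg
    rcases hcard.eq_or_lt with h3 | h4
    · right
      obtain ⟨x, y, hxy, he⟩ := Finset.card_eq_two.1 (show (C.erase j).card = 2 by omega)
      have hx : x ∈ C.erase j := by simp [he]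
      have hy : y ∈ C.erase j := by simp [he]
      have hCe : C = {j, x, y} := by rw [← Finset.insert_erase hjC, he]
      refine ⟨x, hg x hx, y, hg y hy, ?_⟩
      rw [hCe] at hC
      exact hC.ranks_triple (Finset.ne_of_mem_erase hx).symm (Finset.ne_of_mem_erase hy).symm hxy
    · left
      obtain ⟨g, hg', e, he', k, hk', hge, hgk, hek⟩ :=
        Finset.two_lt_card.1 (show 2 < (C.erase j).card by omega)
      have hkα := hg k hk'
      simp only [Finset.mem_erase] at hg' he' hk'
      intro a b _ _ h
      exact hC.exists_eq_log_nat h hjC hg'.2 he'.2 hg'.1.symm he'.1.symm hge hjα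
        (Or.inr ⟨k, hk'.2, hkα, hgk.symm, hek.symm⟩)

end Classification

section Classification

variable {n : ℕ} {r : SetFn n} {α : Finset (Fin n)}

/-- An element of `α` that is a loop, or a third independent element of `α`, provides a common
part of `x` and `y`. -/
theorem logIntegral_of_triple (hr : IsMatroidRank r) {j x y : Fin n} (hjα : j ∉ α) (hx : x ∈ α)
    (hy : y ∈ α) (hjx : r {j, x} = 2) (hjy : r {j, y} = 2) (hxy : r {x, y} = 2)
    (hjxy : r {j, x, y} = 2) (hz : (∃ k ∈ α, r {k} = 0) ∨ ∃ z ∈ α, r {z, x, y} = 3) :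
    LogIntegral r α := by
  intro a b _ _ h
  obtain ⟨Ω, _, p, S, hp, h1, hS⟩ := exists_entFn_of_mem_GamStar h
  have rj := hr.left_of_pair hjx
  have rx := hr.left_of_pair hxy
  have ry := hr.right_of_pair hxy
  rcases hz with ⟨k, hk, rk⟩ | ⟨z, hzα, rz⟩
  · have hkZ : ∀ w ∈ α, r {w} = 1 → S w ≤ S k := by
      intro w hw rw1
      refine le_of_ent_inf_le hp (s := S k) ?_
      have rkw : r {k, w} = 1 := by
        rw [hr.insert_eq_of_subset (Finset.empty_subset {w}) (by simpa [hr.rank_empty] using rk),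
          rw1]
      rw [ent_inf_pair hS hw, ent_singleton_eq_of_mem hS hw, rw1, rkw]
    refine exists_eq_log_nat_of_common hp h1 hS hjα hx hy rj rx ry hjx hjy hxy hjxy
      (hkZ x hx rx) (hkZ y hy ry) ?_
    rw [ent_singleton_eq_of_mem hS hk, rk]
    linarith
  · obtain ⟨rzx, rzy, -⟩ := hr.pairs_of_triple rz
    have hZ := common_part_of_indep hp h1 hS hx hy hzα rx ry (hr.left_of_pair rzx) hxy rzx rzy rz
    exact exists_eq_log_nat_of_common hp h1 hS hjα hx hy rj rx ry hjx hjy hxy hjxy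
      le_sup_left le_sup_right hZ.1.ge

/-- The case of rank at least three with a nonloop outside `α`. -/
theorem logIntegral_of_three_le (hr : IsMatroidRank r) (hray : SpansExtremeRay r)
    (hrank : 3 ≤ r Finset.univ) {j : Fin n} (hjα : j ∉ α) (hj : r {j} ≠ 0) :
    LogIntegral r α := by
  have hrank2 : 2 ≤ r Finset.univ := by linarith
  rcases logIntegral_or_exists_triple hr hray hrank2 hjα hj with h |
    ⟨x, hx, y, hy, hjx, hjy, hxy, hjxy⟩
  · exact h
  by_cases hz : ∃ z ∈ α, r {z, x, y} = 3
  · exact logIntegral_of_triple hr hjα hx hy hjx hjy hxy hjxy (Or.inr hz)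
  push Not at hz
  have hspan : r ({x, y} ∪ α) = 2 := by
    rw [hr.union_eq_of_forall fun z hzα => ?_, hxy]
    by_contra hne
    have h1 := hr.insert_le z {x, y}
    have h2 := hr.add_one_le
      (lt_of_le_of_ne (hr.mono (Finset.subset_insert z {x, y})) (Ne.symm hne))
    exact hz z hzα (by linarith)
  -- Now `α` lies on the line through `x` and `y`, so some `k` lies off it. An escaping triple for
  -- `k` would have its other two elements in `α` and put `k` on that line.
  obtain ⟨k, -, hk⟩ := hr.exists_insert_eq_add_one (A := {x, y} ∪ α) (B := Finset.univ)
    (by rw [hspan]; linarith)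
  have hkα : k ∉ α := fun h => by
    rw [Finset.insert_eq_of_mem (Finset.mem_union_right _ h)] at hk
    linarith
  have hk0 : r {k} ≠ 0 := fun h => by
    rw [hr.insert_eq_of_subset (Finset.empty_subset _) (by simpa [hr.rank_empty] using h)] at hk
    linarith
  rcases logIntegral_or_exists_triple hr hray hrank2 hkα hk0 with h |
    ⟨x', hx', y', hy', -, -, hxy', hkxy'⟩
  · exact h
  · have hsub : ({x', y'} : Finset (Fin n)) ⊆ {x, y} ∪ α := by
      intro w hw
      rcases Finset.mem_insert.1 hw with rfl | hw
      · exact Finset.mem_union_right _ hx'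
      · rw [Finset.mem_singleton.1 hw]; exact Finset.mem_union_right _ hy'
    rw [hr.insert_eq_of_subset hsub (by rw [hkxy', hxy'])] at hk
    linarith

/-- If all nonloops are in `α`, and `α` contains a loop or the rank is at least three, then an
entropic point of the face provides an entropic multiple of `r`. -/
theorem charSet_nonempty_of_entropic (hr : IsMatroidRank r) (hray : SpansExtremeRay r)
    (hrank : 2 ≤ r Finset.univ) (hloop : ∀ i ∉ α, r {i} = 0)
    (hα : (∃ k ∈ α, r {k} = 0) ∨ (∀ k ∈ α, r {k} ≠ 0) ∧ 3 ≤ r Finset.univ) {a b : ℝ} (ha : 0 < a)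
    (h : a • r + b • uniformRank 1 α ∈ GamStar n) : (charSet r).Nonempty := by
  obtain ⟨Ω, _, p, S, hp, h1, hS⟩ := exists_entFn_of_mem_GamStar h
  rcases hα with ⟨k, hk, rk⟩ | ⟨hα, hrank3⟩
  · refine charSet_nonempty_of_common hr hray hrank hp h1 hS ha hloop (Z := S k) (fun w hw => ?_) ?_
    · refine le_of_ent_inf_le hp (s := S k) ?_
      rw [ent_inf_pair hS hw, ent_singleton_eq_of_mem hS hw,
        hr.insert_eq_of_subset (Finset.empty_subset {w}) (by simpa [hr.rank_empty] using rk)]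
    · rw [ent_singleton_eq_of_mem hS hk, rk]; ring
  · have hrα : r Finset.univ ≤ r α := by
      have h2 := hr.union_le α αᶜ
      rw [Finset.union_compl, hr.eq_zero_of_loops (A := αᶜ) fun i hi =>
        hloop i (Finset.mem_compl.1 hi)] at h2
      linarith
    obtain ⟨y, hy, ry⟩ := hr.exists_insert_eq_add_one (A := ∅) (B := α)
      (by rw [hr.rank_empty]; linarith)
    simp only [hr.rank_empty, zero_add, insert_empty_eq] at ry
    obtain ⟨x, hx, hxy⟩ := hr.exists_insert_eq_add_one (A := {y}) (B := α) (by linarith)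
    rw [ry] at hxy
    obtain ⟨z, hz, rz⟩ := hr.exists_insert_eq_add_one (A := {x, y}) (B := α) (by linarith)
    have hxy2 : r {x, y} = 2 := by linarith
    have rz3 : r {z, x, y} = 3 := by linarith
    obtain ⟨rzx, rzy, -⟩ := hr.pairs_of_triple rz3
    have rx := hr.left_of_pair hxy2
    have rz1 := hr.left_of_pair rzx
    have hZ := common_part_of_indep hp h1 hS hx hy hz rx ry rz1 hxy2 rzx rzy rz3
    refine charSet_nonempty_of_common hr hray hrank hp h1 hS ha hloop (Z := S x ⊔ S y)
      (fun w hw => ?_) hZ.1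
    have rw1 := hr.singleton_eq_one (hα w hw)
    by_cases hw3 : r {w, x, y} = 3
    · obtain ⟨rwx, rwy, -⟩ := hr.pairs_of_triple hw3
      exact (common_part_of_indep hp h1 hS hx hy hw rx ry rw1 hxy2 rwx rwy hw3).2
    · have hw2 : r {w, x, y} = 2 := by
        by_contra hne
        have h2 := hr.insert_le w {x, y}
        have h3 := hr.mono (Finset.subset_insert w {x, y})
        have h4 := hr.add_one_le (lt_of_le_of_ne h3 (by rw [hxy2]; exact Ne.symm hne))
        exact hw3 (by linarith)
      -- When `w` is on the line through `x` and `y`, choose `u` among them not parallel to `w`.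
      -- Then `w`, `u`, `z` are independent, so `w` determines `S u ⊔ S z`; both `S u` and `S z`
      -- refine the common part of `x` and `y`.
      have key : ∀ u v : Fin n, u ∈ α → r {u} = 1 → r {w, u} = 2 → r {z, u} = 2 →
          r {w, u, v} = 2 → r {z, u, v} = 3 → S w ≤ S u ⊔ S z := by
        intro u v hu ru hwu hzu hwuv hzuv
        have h3 : r {w, u, z} = 3 := by
          by_contra hne
          have hle : r {w, u, z} ≤ 3 := by
            have := hr.insert_le z {w, u}
            rw [show insert z ({w, u} : Finset (Fin n)) = {w, u, z} by
              ext a; simp; tauto] at this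
            linarith
          have hz2 : r (insert z {w, u}) = r {w, u} := by
            by_contra hne2
            have := hr.add_one_le (lt_of_le_of_ne (hr.mono (Finset.subset_insert z {w, u}))
              (Ne.symm hne2))
            rw [show insert z ({w, u} : Finset (Fin n)) = {w, u, z} by
              ext a; simp; tauto] at this
            exact hne (by linarith)
          have hv2 : r (insert v {w, u}) = r {w, u} := by
            rw [show insert v ({w, u} : Finset (Fin n)) = {w, u, v} by
              ext a; simp; tauto, hwuv, hwu]
          -- Were the rank not three, `z` and `v` would both be in the span of `w` and `u`, against
          -- the independence of `z`, `u`, `v`.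
          have hU := hr.union_eq_of_forall (A := {w, u}) (B := {z, v}) (by
            intro a ha
            rcases Finset.mem_insert.1 ha with rfl | ha
            · exact hz2
            · rw [Finset.mem_singleton.1 ha]; exact hv2)
          have hsub : ({z, u, v} : Finset (Fin n)) ⊆ {w, u} ∪ {z, v} := by
            intro a; simp; tauto
          have := hr.mono hsub
          linarith
        have hperm : r {u, z} = 2 := by rw [Finset.pair_comm]; exact hzu
        have hwz := (hr.pairs_of_triple h3).2.1
        exact (common_part_of_indep hp h1 hS hu hz hw ru rz1 rw1 hperm hwu hwz h3).2
      rcases hr.pair_or_pair rw1 hxy2 with hwx | hwy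
      · exact (key x y hx rx hwx rzx hw2 rz3).trans (sup_le le_sup_left hZ.2)
      · refine (key y x hy ry hwy rzy ?_ ?_).trans (sup_le le_sup_right hZ.2)
        · rw [Finset.pair_comm y x]; exact hw2
        · rw [Finset.pair_comm y x]; exact rz3

/-- All points are entropic if some multiple of `r` is and if all nonloops are in `α`. -/
theorem entropic_of_charSet_nonempty (hr : IsMatroidRank r) (hloop : ∀ i ∉ α, r {i} = 0)
    (hχ : (charSet r).Nonempty) {a b : ℝ} (ha : 0 < a) (hb : 0 < b) :
    a • r + b • uniformRank 1 α ∈ GamStar n := by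
  obtain ⟨v, hv, hvr⟩ := hχ
  have hlog : 0 < Real.log v := Real.log_pos (by exact_mod_cast hv)
  -- The switch probability `θ = a / ((N + 1) log v)` turns `N + 1` independent copies of `log v •
  -- r` into mean `a • r`. For large `N` the switch entropy is below `b`, and an independent
  -- multiple of `U_{1,α}` supplies the rest.
  have hlim : Filter.Tendsto (fun N : ℕ => a / Real.log v * (1 / ((N : ℝ) + 1))) Filter.atTop
      (nhds 0) := by
    simpa using tendsto_one_div_add_atTop_nhds_zero_nat.const_mul (a / Real.log v)
  have hent : Filter.Tendsto (fun N : ℕ => Real.binEntropy (a / Real.log v * (1 / ((N : ℝ) + 1))))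
      Filter.atTop (nhds 0) := by
    simpa [Function.comp_def] using (Real.binEntropy_continuous.tendsto 0).comp hlim
  obtain ⟨N, hN1, hN2⟩ := ((hent.eventually (gt_mem_nhds hb)).and
    (hlim.eventually (gt_mem_nhds zero_lt_one))).exists
  set θ := a / Real.log v * (1 / ((N : ℝ) + 1)) with hθ
  have hθ0 : 0 < θ := by positivity
  have hmul : ∀ m : ℕ, ((m : ℝ) + 1) • Real.log v • r ∈ GamStar n := by
    intro m
    induction m with
    | zero => simpa using hvr
    | succ m ih =>
      have := add_mem_GamStar ih hvr
      convert this using 1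
      rw [add_smul ((m + 1 : ℕ) : ℝ), one_smul]
      push_cast
      rfl
  have hrα : ∀ A, r A = r (A ∩ α) := by
    intro A
    refine le_antisymm ?_ (hr.mono Finset.inter_subset_left)
    have := hr.union_eq_of_forall (A := A ∩ α) (B := A \ α) fun x hx =>
      hr.insert_eq_of_subset (Finset.empty_subset _)
        (by simpa [hr.rank_empty] using hloop x (Finset.mem_sdiff.1 hx).2)
    rw [Finset.union_comm, Finset.sdiff_union_inter] at this
    exact this.le
  have h := add_mem_GamStar (mixture_mem_GamStar (hmul N) α
    (fun A => by simp only [Pi.smul_apply, hrα A]) hθ0 hN2)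
    (smul_uniformRank_one_mem_GamStar α (sub_nonneg.2 hN1.le))
  convert h using 1
  rw [add_assoc, ← add_smul, add_sub_cancel, smul_smul, smul_smul]
  congr 2
  rw [hθ]
  field_simp

/-- A rank-one matroid has only entropic multiples. -/
theorem entropic_of_rank_lt_two (hr : IsMatroidRank r) (hrank : r Finset.univ < 2) {a b : ℝ}
    (ha : 0 < a) (hb : 0 < b) : a • r + b • uniformRank 1 α ∈ GamStar n := by
  have hru : r Finset.univ ≤ 1 := by
    obtain ⟨k, hk⟩ := hr.2.1 Finset.univ
    rw [hk] at hrank ⊢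
    have h2 : k < 2 := by exact_mod_cast hrank
    exact_mod_cast (show k ≤ 1 by omega)
  classical
  have hre : r = uniformRank 1 (Finset.univ.filter fun i => r {i} ≠ 0) := by
    funext A
    by_cases hA : ∃ i ∈ A, r {i} ≠ 0
    · obtain ⟨i, hi, hi0⟩ := hA
      rw [uniformRank_one_of_mem hi (by simpa using hi0)]
      have h1 := hr.mono (Finset.singleton_subset_iff.2 hi)
      rw [hr.singleton_eq_one hi0] at h1
      exact le_antisymm ((hr.mono (Finset.subset_univ A)).trans hru) h1
    · push Not at hA
      rw [uniformRank_one_of_forall (by simpa using hA), hr.eq_zero_of_loops hA]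
  rw [hre]
  exact add_mem_GamStar (smul_uniformRank_one_mem_GamStar _ ha.le)
    (smul_uniformRank_one_mem_GamStar _ hb.le)

end Classification

/-! ### Rank two: the Matúš conditions and the excluded configuration -/

section RankTwo

open Classical in
/-- If `f` is independent of `e` and of `g` and each of the three is a function of the other two,
then `e` takes each of its values with probability at most the inverse of the number of values of
`f`. -/
theorem log_card_le_ent {Ω : Type*} [Fintype Ω] [Nonempty Ω] {p : Ω → ℝ} (hp : ∀ ω, 0 < p ω)
    (h1 : ∑ ω, p ω = 1) {f e g : Setoid Ω} (hef : CondIndep p e f ⊤) (hgf : CondIndep p g f ⊤)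
    (hg : e ⊓ f ≤ g) (he : g ⊓ f ≤ e) (hf : e ⊓ g ≤ f) :
    Real.log (Nat.card (Quotient f)) ≤ ent p e := by
  have hm : (0 : ℝ) < Nat.card (Quotient f) := by exact_mod_cast card_quotient_pos f
  have heq : ∀ ω, prob p e ω = prob p g ω := fun ω => by
    have a := hef.prob_mul hp h1 ω
    have b := hgf.prob_mul hp h1 ω
    rw [le_antisymm (le_inf hg inf_le_right) (le_inf he inf_le_right), ← b] at a
    exact mul_right_cancel₀ (prob_pos hp f ω).ne' a
  have hle : ∀ ω, Nat.card (Quotient f) * prob p e ω ≤ 1 := by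
    intro ω
    -- Each value of `f` occurs together with the `e`-value of `ω`. The `g`-blocks of these points
    -- are disjoint, because `e` and `g` determine `f`, and each has the probability of the
    -- `e`-block of `ω`; their total is at most `1`.
    have hex : ∀ c : Quotient f, ∃ x, e x ω ∧ Quotient.mk f x = c := by
      intro c
      induction c using Quotient.inductionOn with
      | h y =>
        obtain ⟨x, hx, hy⟩ := hef.exists_of_rel hp h1 (x := ω) (y := y) (by trivial)
        exact ⟨x, hx, Quotient.sound (s := f) hy⟩
    choose z hz hzc using hex
    have hsum : ∑ c : Quotient f, prob p g (z c) = Nat.card (Quotient f) * prob p e ω := by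
      simp only [← heq, prob_congr (hz _)]
      simp [Nat.card_eq_fintype_card]
    rw [← hsum, ← h1]
    simp only [prob]
    rw [Finset.sum_comm]
    refine Finset.sum_le_sum fun x _ => ?_
    by_cases hx : ∃ c, g x (z c)
    · obtain ⟨c, hc⟩ := hx
      rw [Finset.sum_eq_single c (fun d _ hd => if_neg fun hgd => hd ?_) (by simp), if_pos hc]
      have h2 : (e ⊓ g) (z d) (z c) :=
        ⟨e.trans' (hz d) (e.symm' (hz c)), g.trans' (g.symm' hgd) hc⟩
      rw [← hzc d, ← hzc c]
      exact Quotient.sound (s := f) (hf h2)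
    · rw [Finset.sum_eq_zero fun c _ => if_neg fun h => hx ⟨c, h⟩]
      exact (hp x).le
  have hlog : ∀ ω, p ω * Real.log (prob p e ω) ≤ p ω * -Real.log (Nat.card (Quotient f)) := by
    intro ω
    refine mul_le_mul_of_nonneg_left ?_ (hp ω).le
    have := Real.log_nonpos (mul_pos hm (prob_pos hp e ω)).le (hle ω)
    rw [Real.log_mul hm.ne' (prob_pos hp e ω).ne'] at this
    linarith
  have := Finset.sum_le_sum fun ω (_ : ω ∈ Finset.univ) => hlog ω
  rw [← Finset.sum_mul, h1] at this
  rw [ent]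
  linarith

variable {n : ℕ} {r : SetFn n} {α : Finset (Fin n)}

/-- The necessary condition of Matúš. -/
theorem log_ceil_exp_le (hr : IsMatroidRank r) {j x y : Fin n} (hjα : j ∉ α) (hx : x ∈ α)
    (hy : y ∈ α) (hjx : r {j, x} = 2) (hjy : r {j, y} = 2) (hxy : r {x, y} = 2)
    (hjxy : r {j, x, y} = 2) {a b : ℝ} (h : a • r + b • uniformRank 1 α ∈ GamStar n) :
    Real.log ⌈Real.exp a⌉ ≤ a + b := by
  obtain ⟨Ω, _, p, S, hp, h1, hS⟩ := exists_entFn_of_mem_GamStar h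
  have := nonempty_of_sum_eq_one h1
  have ej : ent p (S j) = a := by
    have : ent p (S j) = entFn p S {j} := by rw [entFn, Finset.inf_singleton]
    rw [this, ← hS]
    simp [uniformRank_one_of_forall (β := α) (A := {j}) (by simpa using hjα),
      hr.left_of_pair hjx]
  have ex := ent_singleton_eq_of_mem hS hx
  have ey := ent_singleton_eq_of_mem hS hy
  have ejx := ent_inf_pair hS (x := j) hx
  have ejy := ent_inf_pair hS (x := j) hy
  have exy := ent_inf_pair hS (x := x) hy
  have ejxy := ent_inf_triple hS (x := j) (y := x) hy
  rw [hr.left_of_pair hxy] at ex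
  rw [hr.right_of_pair hxy] at ey
  rw [hjx] at ejx; rw [hjy] at ejy; rw [hxy] at exy; rw [hjxy] at ejxy
  have hle := log_card_le_ent hp h1 (f := S j) (e := S x) (g := S y)
    ⟨le_top, le_top, by rw [inf_comm, ent_top h1, ejx, ex, ej]; linarith⟩
    ⟨le_top, le_top, by rw [inf_comm, ent_top h1, ejy, ey, ej]; linarith⟩
    ((le_of_ent_inf_le hp (s := S y) (by
      rw [inf_comm (S x), inf_left_comm, inf_comm (S y), ejxy, ejx])))
    ((le_of_ent_inf_le hp (s := S x) (by
      rw [inf_comm (S y), inf_left_comm, ejxy, ejy])))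
    (le_of_ent_inf_le hp (by rw [ejxy, exy]))
  rw [ex] at hle
  have hcard := ent_le_log_card hp h1 (S j)
  rw [ej] at hcard
  have hm : (0 : ℝ) < Nat.card (Quotient (S j)) := by exact_mod_cast card_quotient_pos (S j)
  have hexp := (Real.le_log_iff_exp_le hm).1 hcard
  -- A variable of entropy `a` has at least `exp a` values, and their number is an integer.
  have hceil : ⌈Real.exp a⌉ ≤ (Nat.card (Quotient (S j)) : ℤ) :=
    Int.ceil_le.2 (by exact_mod_cast hexp)
  have hceil0 : (0 : ℝ) < ⌈Real.exp a⌉ := by exact_mod_cast Int.ceil_pos.2 (Real.exp_pos a)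
  have := Real.log_le_log hceil0 (show (⌈Real.exp a⌉ : ℝ) ≤ (Nat.card (Quotient (S j)) : ℝ) by
    exact_mod_cast hceil)
  linarith

/-- The sufficient condition of Matúš: the distribution of the variable `j` in a representation of
a rank-two matroid is changed. -/
theorem entropic_of_mem_charSet (hr : IsMatroidRank r) (hrank : r Finset.univ = 2) {j : Fin n}
    (hj : r {j} = 1) (hα : ∀ i, i ∈ α ↔ r {i, j} = 2) {v : ℤ} (hv : v ∈ charSet r) {a b : ℝ}
    (ha : 0 ≤ a) (hav : a ≤ Real.log v) (hab : Real.log v ≤ a + b) :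
    a • r + b • uniformRank 1 α ∈ GamStar n := by
  classical
  obtain ⟨Ω, _, p, S, hp, h1, hS⟩ := exists_entFn_of_mem_GamStar hv.2
  have := nonempty_of_sum_eq_one h1
  have hval : ∀ A : Finset (Fin n), ent p (A.inf S) = Real.log v * r A := fun A => by
    rw [← smul_eq_mul, ← Pi.smul_apply, hS, entFn]
  have hval1 : ∀ i, ent p (S i) = Real.log v * r {i} := fun i => by
    rw [← hval, Finset.inf_singleton]
  have hle : ∀ A B : Finset (Fin n), A ⊆ B → r B = r A → A.inf S = B.inf S := fun A B hAB h =>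
    le_antisymm (le_of_ent_le hp (Finset.inf_mono hAB) (by rw [hval, hval, h]))
      (Finset.inf_mono hAB)
  have hnonempty : Nonempty (Quotient (S j)) := ‹Nonempty Ω›.map (Quotient.mk _)
  obtain ⟨q, hq, hqa⟩ := exists_ent_bot_eq (Ω := Quotient (S j)) ha (by
    have := ent_le_log_card hp h1 (S j)
    rw [hval1, hj, Nat.card_eq_fintype_card] at this
    linarith)
  have hind : ∀ A : Finset (Fin n), r A = 1 → r (insert j A) = 2 →
      CondIndep p (A.inf S) (S j) ⊤ := fun A hA hjA =>
    ⟨le_top, le_top, by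
      rw [ent_top h1, inf_comm, ← Finset.inf_insert, hval, hval, hval1, hA, hjA, hj]; linarith⟩
  have hmem := reweight_mem hp (S j) hq
  -- Give `X_j` a law of entropy `a`. A rank-one set meeting `α` is independent of `j` and keeps
  -- entropy `log v`; a rank-two set meeting `α` is equivalent to some `{i, j}` and gets `log v +
  -- a`; a set missing `α` is constant or equivalent to `j`.
  have hface : a • r + (Real.log v - a) • uniformRank 1 α = entFn (reweight p (S j) q) S := by
    funext A
    rw [Pi.add_apply, Pi.smul_apply, Pi.smul_apply, smul_eq_mul, smul_eq_mul, entFn]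
    by_cases hA : ∃ i ∈ A, i ∈ α
    · obtain ⟨i, hiA, hiα⟩ := hA
      have hij := (hα i).1 hiα
      have hi := hr.left_of_pair hij
      rw [uniformRank_one_of_mem hiA hiα]
      by_cases hA1 : r A = 1
      · have hjA : r (insert j A) = 2 := by
          refine le_antisymm (hrank ▸ hr.mono (Finset.subset_univ _)) ?_
          rw [← hij, Finset.pair_comm]
          exact hr.mono (Finset.insert_subset_insert j (Finset.singleton_subset_iff.2 hiA))
        rw [ent_reweight_of_indep hp h1 (hind A hA1 hjA) hq, hval, hA1]
        ring
      · have hA2 : r A = 2 := by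
          refine le_antisymm (hrank ▸ hr.mono (Finset.subset_univ _)) ?_
          have h2 := hr.mono (Finset.singleton_subset_iff.2 hiA)
          rw [hi] at h2
          have := hr.add_one_le (A := {i}) (B := A) (by
            rw [hi]; exact lt_of_le_of_ne h2 (Ne.symm hA1))
          linarith
        rw [hle A Finset.univ (Finset.subset_univ _) (by rw [hrank, hA2]),
          ← hle {i, j} Finset.univ (Finset.subset_univ _) (by rw [hrank, hij]),
          Finset.inf_insert, Finset.inf_singleton]
        have := hind {i} hi (by rw [Finset.pair_comm]; exact hij)
        rw [Finset.inf_singleton] at this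
        rw [ent_reweight_inf hp h1 this hq, hval1, hi, hqa, hA2]
        ring
    · have hA' : ∀ i ∈ A, i ∉ α := fun i hi hiα => hA ⟨i, hi, hiα⟩
      rw [uniformRank_one_of_forall hA']
      have hjA : r (insert j A) = 1 := by
        rw [Finset.insert_eq, hr.union_eq_of_forall fun i hi => ?_, hj]
        by_contra hne
        have h2 := hr.insert_le i {j}
        have h3 := hr.add_one_le
          (lt_of_le_of_ne (hr.mono (Finset.subset_insert i {j})) (Ne.symm hne))
        exact hA' i hi ((hα i).2 (by linarith))
      by_cases hA0 : r A = 0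
      · have hempty := hle ∅ A (Finset.empty_subset A) (by rw [hA0, hr.rank_empty])
        rw [← hempty, Finset.inf_empty, ent_top hmem.2, hA0]
        ring
      · have hA1 : r A = 1 := by
          refine le_antisymm (hjA ▸ hr.mono (Finset.subset_insert j A)) ?_
          have := hr.add_one_le (A := ∅) (B := A) (by
            rw [hr.rank_empty]; exact lt_of_le_of_ne (hr.1.2.1 A) (Ne.symm hA0))
          rw [hr.rank_empty] at this
          linarith
        rw [hle A (insert j A) (Finset.subset_insert j A) (by rw [hjA, hA1]),
          ← hle {j} (insert j A) (by simp) (by rw [hjA, hj]), Finset.inf_singleton,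
          ent_reweight hp, hqa, hA1]
        ring
  have h := add_mem_GamStar (hface ▸ entFn_mem_GamStar hmem S)
    (smul_uniformRank_one_mem_GamStar α (sub_nonneg.2 hab))
  convert h using 1
  rw [add_assoc, ← add_smul]
  congr 2
  ring

/-- In rank two, a parallel class that meets `α` and whose complement is contained in `α` yields
a further decomposition of `r + U_{1,α}`. -/
theorem not_twoFace_of_parallel_class (hr : IsMatroidRank r) (hrank : r Finset.univ = 2)
    (hα : ∀ i ∈ α, r {i} ≠ 0) {j e : Fin n} (hj : r {j} = 1) (hje : r {e, j} = 1) (he : e ∈ α)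
    (hP : ∀ i ∉ α, r {i, j} = 1)
    (hface : IsFace {h : SetFn n | ∃ a b : ℝ, 0 ≤ a ∧ 0 ≤ b ∧ h = a • r + b • uniformRank 1 α} 2) :
    False := by
  classical
  set P : Finset (Fin n) := Finset.univ.filter fun i => r {i, j} = 1 with hPdef
  have hmemP : ∀ i, i ∈ P ↔ r {i, j} = 1 := fun i => by simp [hPdef]
  have hrP : r P = 1 := by
    refine le_antisymm ?_ ?_
    · have h := hr.union_eq_of_forall (A := {j}) (B := P) fun i hi => by
        rw [hj]; exact (hmemP i).1 hi
      rw [← hj, ← h]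
      exact hr.mono Finset.subset_union_right
    · rw [← hj]
      exact hr.mono (Finset.singleton_subset_iff.2 ((hmemP j).2 (by simpa using hj)))
  have hpair : ∀ i ∉ P, ∀ k ∈ P, r {k} ≠ 0 → r {i, k} = 2 := by
    intro i hi k hk hk0
    refine le_antisymm (hrank ▸ hr.mono (Finset.subset_univ _)) ?_
    by_contra hlt
    have hk1 := hr.singleton_eq_one hk0
    have h1 : r (insert i {k}) = r {k} := by
      by_contra hne
      have := hr.add_one_le (lt_of_le_of_ne (hr.mono (Finset.subset_insert i {k})) (Ne.symm hne))
      exact hlt (by linarith)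
    have h2 : r (insert i P) = 1 := by
      rw [hr.insert_eq_of_subset (Finset.singleton_subset_iff.2 hk) h1, hrP]
    refine hi ((hmemP i).2 (le_antisymm ?_ ?_))
    · rw [← h2]
      refine hr.mono (Finset.insert_subset_insert i (Finset.singleton_subset_iff.2 ?_))
      exact (hmemP j).2 (by simpa using hj)
    · rw [← hj]; exact hr.mono (by simp)
  -- As `Pᶜ ⊆ α`, one has `U_{1,α} = δ + U_{1,Pᶜ}`. Alone `δ` is not monotone, but `r + δ` is a
  -- polymatroid: it is bounded by `2` and equals `2` on every set containing one where `δ` is `1`.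
  set δ : SetFn n := fun A => if A ⊆ P ∧ ∃ i ∈ A, i ∈ α then 1 else 0 with hδ
  have hδle : ∀ A, δ A ≤ 1 := fun A => by simp only [hδ]; split_ifs <;> norm_num
  have hδ0 : ∀ A, 0 ≤ δ A := fun A => by simp only [hδ]; split_ifs <;> norm_num
  have hδ1 : ∀ A, (A ⊆ P ∧ ∃ i ∈ A, i ∈ α) → δ A = 1 := fun A h => if_pos h
  have hδ2 : ∀ A, ¬ (A ⊆ P ∧ ∃ i ∈ A, i ∈ α) → δ A = 0 := fun A h => if_neg h
  have hle2 : ∀ A, r A + δ A ≤ 2 := fun A => by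
    by_cases h : A ⊆ P ∧ ∃ i ∈ A, i ∈ α
    · have := hr.mono h.1
      linarith [hδle A]
    · rw [hδ2 A h, ← hrank]
      linarith [hr.mono (Finset.subset_univ A)]
  have heq2 : ∀ A B, A ⊆ B → (A ⊆ P ∧ ∃ i ∈ A, i ∈ α) → r B + δ B = 2 := by
    intro A B hAB ⟨hAP, i, hiA, hiα⟩
    by_cases hBP : B ⊆ P
    · rw [hδ1 B ⟨hBP, i, hAB hiA, hiα⟩]
      have h1 := hr.mono hBP
      have h2 := hr.mono (Finset.singleton_subset_iff.2 (hAB hiA))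
      rw [hr.singleton_eq_one (hα i hiα)] at h2
      linarith
    · obtain ⟨k, hkB, hkP⟩ := Finset.not_subset.1 hBP
      have h1 := hpair k hkP i (hAP hiA) (hα i hiα)
      have h2 : r {k, i} ≤ r B := hr.mono (by
        intro w hw
        rcases Finset.mem_insert.1 hw with rfl | hw
        · exact hkB
        · rw [Finset.mem_singleton.1 hw]; exact hAB hiA)
      linarith [hle2 B, hδ0 B]
  have hmem : r + δ ∈ Gam n := by
    refine ⟨?_, fun A => add_nonneg (hr.1.2.1 A) (hδ0 A), fun A B hAB => ?_, fun A B => ?_⟩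
    · rw [Pi.add_apply, hr.rank_empty, hδ2 ∅ (by simp), add_zero]
    · simp only [Pi.add_apply]
      by_cases hA : A ⊆ P ∧ ∃ i ∈ A, i ∈ α
      · rw [heq2 A B hAB hA]; exact hle2 A
      · rw [hδ2 A hA]; linarith [hr.mono hAB, hδ0 B]
    · simp only [Pi.add_apply]
      by_cases hI : A ∩ B ⊆ P ∧ ∃ i ∈ A ∩ B, i ∈ α
      · rw [heq2 _ A Finset.inter_subset_left hI, heq2 _ B Finset.inter_subset_right hI]
        linarith [hle2 (A ∩ B), hle2 (A ∪ B)]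
      · rw [hδ2 _ hI]
        by_cases hU : A ∪ B ⊆ P ∧ ∃ i ∈ A ∪ B, i ∈ α
        · obtain ⟨hUP, i, hi, hiα⟩ := hU
          have hsum : 1 ≤ δ A + δ B := by
            rcases Finset.mem_union.1 hi with hi | hi
            · rw [hδ1 A ⟨Finset.subset_union_left.trans hUP, i, hi, hiα⟩]
              linarith [hδ0 B]
            · rw [hδ1 B ⟨Finset.subset_union_right.trans hUP, i, hi, hiα⟩]
              linarith [hδ0 A]
          linarith [hr.1.2.2.2 A B, hδle (A ∪ B)]
        · rw [hδ2 _ hU]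
          linarith [hr.1.2.2.2 A B, hδ0 A, hδ0 B]
  have hsum : (r + δ) + uniformRank 1 Pᶜ = (1 : ℝ) • r + (1 : ℝ) • uniformRank 1 α := by
    funext A
    simp only [Pi.add_apply, Pi.smul_apply, smul_eq_mul, one_mul, add_assoc]
    congr 1
    by_cases hA : A ⊆ P
    · rw [uniformRank_one_of_forall (β := Pᶜ) fun i hi => by simpa using hA hi, add_zero]
      by_cases hAα : ∃ i ∈ A, i ∈ α
      · rw [hδ1 A ⟨hA, hAα⟩, uniformRank_one, if_pos hAα]
      · rw [hδ2 A fun h => hAα h.2, uniformRank_one, if_neg hAα]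
    · obtain ⟨k, hkA, hkP⟩ := Finset.not_subset.1 hA
      have hkα : k ∈ α := by
        by_contra h
        exact hkP ((hmemP k).2 (hP k h))
      rw [hδ2 A fun h => hA h.1, uniformRank_one_of_mem hkA hkα,
        uniformRank_one_of_mem hkA (Finset.mem_compl.2 hkP), zero_add]
  -- The face would contain `U_{1,Pᶜ} = a • r + b • U_{1,α}`. At `e` this reads `0 = a + b`, so both
  -- coefficients vanish, while `U_{1,Pᶜ}` is nonzero off `P`.
  obtain ⟨a, b, ha, hb, hab⟩ := (mem_face_of_add hface.1 hface.2.1 hmem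
    (uniformRank_one_mem_Gam Pᶜ) ⟨1, 1, zero_le_one, zero_le_one, hsum⟩).2
  have h1 := congrFun hab {e}
  rw [uniformRank_one_of_forall (β := Pᶜ) (A := {e}) (by simpa using (hmemP e).2 hje)] at h1
  simp only [Pi.add_apply, Pi.smul_apply, smul_eq_mul,
    uniformRank_one_of_mem (Finset.mem_singleton_self e) he,
    hr.singleton_eq_one (hα e he), mul_one] at h1
  obtain ⟨k, hk⟩ : ∃ k, k ∉ P := by
    by_contra hcon
    push Not at hcon
    have := hr.mono (fun i _ => hcon i : Finset.univ ⊆ P)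
    linarith
  have h2 := congrFun hab {k}
  rw [uniformRank_one_of_mem (Finset.mem_singleton_self k) (Finset.mem_compl.2 hk),
    show a = 0 by linarith, show b = 0 by linarith] at h2
  simp at h2

end RankTwo

end EntropyFaces

/-! ### The case analysis -/

theorem mainTheorem1 (n n' : ℕ) (hn' : 1 ≤ n') (hn : n' ≤ n)
    (r : EntropyFaces.SetFn n) (hr : EntropyFaces.IsMatroidRank r)
    (hray : EntropyFaces.SpansExtremeRay r)
    (hface : EntropyFaces.IsTwoFace r (EntropyFaces.rankOne n n')) :
    EntropyFaces.AllEntropic r n' ∨ EntropyFaces.MatusType r n' ∨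
      EntropyFaces.ChenYeungType r n' ∨ EntropyFaces.NonEntropic r n' := by
  open EntropyFaces in
  set α : Finset (Fin n) := Finset.univ.filter fun i : Fin n => i.val < n' with hα
  have hU : rankOne n n' = uniformRank 1 α := rfl
  have hCY : LogIntegral r α → ChenYeungType r n' := by
    intro h
    refine ⟨fun v hv b hb => ?_, fun a b ha hb hav hent => ?_⟩
    · exact add_mem_GamStar hv.2 (smul_uniformRank_one_mem_GamStar α hb.le)
    · rcases ha.eq_or_lt with rfl | ha
      -- The value `a = 0` is allowed as `log 1`.
      · exact hav 1 le_rfl (by simp)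
      · obtain ⟨N, hN, hNa⟩ := h a b ha hb hent
        exact hav N (by exact_mod_cast hN) (by simpa using hNa)
  by_cases hrank : r Finset.univ < 2
  · exact Or.inl fun a b ha hb => entropic_of_rank_lt_two hr hrank ha hb
  rw [not_lt] at hrank
  have hthree : r Finset.univ ≠ 2 → 3 ≤ r Finset.univ := by
    intro hne
    obtain ⟨k, hk⟩ := hr.2.1 Finset.univ
    rw [hk] at hrank hne ⊢
    have h2 : 2 ≤ k := by exact_mod_cast hrank
    have h3 : k ≠ 2 := by exact_mod_cast hne
    exact_mod_cast (show 3 ≤ k by omega)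
  have hpair1 : ∀ i j : Fin n, r {j} = 1 → r {i, j} ≠ 2 → r {i, j} = 1 := by
    intro i j hj hne
    by_contra h1
    have h2 := hr.insert_le i {j}
    have h3 := hr.mono (Finset.subset_insert i {j})
    have h4 := hr.add_one_le (lt_of_le_of_ne h3 (by rw [hj]; exact Ne.symm h1))
    exact hne (by linarith)
  by_cases hout : ∃ j ∉ α, r {j} ≠ 0
  · obtain ⟨j, hjα, hj0⟩ := hout
    have hj := hr.singleton_eq_one hj0
    rcases logIntegral_or_exists_triple hr hray hrank hjα hj0 with h |
      ⟨x, hx, y, hy, hjx, hjy, hxy, hjxy⟩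
    · exact Or.inr (Or.inr (Or.inl (hCY h)))
    by_cases hk : ∃ k ∈ α, r {k} = 0
    · exact Or.inr (Or.inr (Or.inl (hCY
        (logIntegral_of_triple hr hjα hx hy hjx hjy hxy hjxy (Or.inl hk)))))
    push Not at hk
    by_cases hrank2 : r Finset.univ = 2
    swap
    · exact Or.inr (Or.inr (Or.inl (hCY
        (logIntegral_of_three_le hr hray (hthree hrank2) hjα hj0))))
    by_cases hg : ∃ g ∉ α, r {g, j} = 2
    · obtain ⟨g, hgα, hgj⟩ := hg
      have hline : ∀ A : Finset (Fin n), ∀ B ⊆ A, r B = 2 → r A = 2 := fun A B hBA hB =>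
        le_antisymm (hrank2 ▸ hr.mono (Finset.subset_univ A)) (hB ▸ hr.mono hBA)
      -- The circuit `{j, g, w}` has two elements outside `α`, so no conditioning is needed; `w` is
      -- whichever of `x`, `y` is not parallel to `g`.
      have key : ∀ w, r {g, w} = 2 → r {j, w} = 2 → LogIntegral r α := by
        intro w hgw hjw a b _ _ h
        have hC := hr.isRankCircuit_triple (by rw [Finset.pair_comm]; exact hgj) hjw hgw
          (hline {j, g, w} {g, w} (by simp) hgw)
        exact hC.exists_eq_log_nat h (by simp) (by simp) (by simp) (hr.ne_of_pair hgj).symm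
          (hr.ne_of_pair hjw) (hr.ne_of_pair hgw) hjα (Or.inl hgα)
      rcases hr.pair_or_pair (hr.left_of_pair hgj) hxy with hgx | hgy
      · exact Or.inr (Or.inr (Or.inl (hCY (key x hgx hjx))))
      · exact Or.inr (Or.inr (Or.inl (hCY (key y hgy hjy))))
    push Not at hg
    by_cases he : ∃ e ∈ α, r {e, j} = 1
    · obtain ⟨e, he, hej⟩ := he
      exact (not_twoFace_of_parallel_class hr hrank2 hk hj hej he
        (fun i hi => hpair1 i j hj (hg i hi)) hface.2.2).elim
    push Not at he
    -- The complement of `α` is now exactly the parallel class of `j` together with the loops, the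
    -- configuration of the Matúš type.
    have hαj : ∀ i, i ∈ α ↔ r {i, j} = 2 := fun i =>
      ⟨fun hi => by_contra fun hne => he i hi (hpair1 i j hj hne),
        fun hi => by_contra fun hiα => hg i hiα hi⟩
    refine Or.inr (Or.inl ⟨fun v hv a b ha _ _ hav hab => ?_, fun a b _ _ hab hent => ?_⟩)
    · exact entropic_of_mem_charSet hr hrank2 hj hαj hv ha hav.le hab
    · exact absurd hab (not_lt.2 (log_ceil_exp_le hr hjα hx hy hjx hjy hxy hjxy hent))
  · push Not at hout
    by_cases hχ : (charSet r).Nonempty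
    · exact Or.inl fun a b ha hb => entropic_of_charSet_nonempty hr hout hχ ha hb
    by_cases hcase : (∃ k ∈ α, r {k} = 0) ∨ (∀ k ∈ α, r {k} ≠ 0) ∧ 3 ≤ r Finset.univ
    · exact Or.inr (Or.inr (Or.inr fun a b ha _ hent =>
        hχ (charSet_nonempty_of_entropic hr hray hrank hout hcase ha hent)))
    push Not at hcase
    have hrank2 : r Finset.univ = 2 := by
      by_contra hne
      exact absurd (hthree hne) (not_le.2 (hcase.2 hcase.1))
    -- Here `α` is exactly the set of nonloops. The parallel class of any nonloop `j`, with the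
    -- loops added, meets `α` in `j` and contains the complement of `α`, so the face cannot exist.
    obtain ⟨j, -, hj⟩ := hr.exists_insert_eq_add_one (A := ∅) (B := Finset.univ)
      (by rw [hr.rank_empty]; linarith)
    simp only [hr.rank_empty, zero_add, insert_empty_eq] at hj
    have hjα : j ∈ α := by
      by_contra h
      rw [hout j h] at hj
      exact zero_ne_one hj
    refine (not_twoFace_of_parallel_class hr hrank2 hcase.1 hj (by simpa using hj) hjα
      (fun i hi => ?_) hface.2.2).elim
    rw [hr.insert_eq_of_subset (Finset.empty_subset _)
      (by simpa [hr.rank_empty] using hout i hi), hj]
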